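/- Fix $q_0>0$. For $\omega\in\mathbb C^2$ put $\omega^\perp=(\overline{\omega_2},-\overline{\omega_1})^T$, and let $\sigma_3=\mathrm{diag}(1,1,-1)$ and, for $v\in\mathbb C^2$, $Q(v)=\begin{pmatrix}0_{2\times2}&v\\-v^\dagger&0\end{pmatrix}$. For $z\in\mathbb C\setminus\{0\}$ put $\lambda=\frac12(z+q_0^2/z)$, $k=\frac12(z-q_0^2/z)$, and let $\Theta=\mathrm{diag}(\theta_1,\theta_2,-\theta_1)$ with $\theta_1=\lambda[x+2(2k^2-q_0^2)t]$, $\theta_2=k(x+4k^2t)$. Choose one of the signs $\pm$. Let $q_\pm\in\mathbb C^2$ with $\|q_\pm\|=q_0$, let $q:\mathbb R\times\mathbb R\to\mathbb C^2$, and fix $t$. Assume that $q(\cdot,t)\in C^2(\mathbb R)$, that $q(x,t)\to q_\pm$ as $x\to\pm\infty$, and that $(1+|x|)(q(x,t)-q_\pm)$, $q_x(x,t)$ and $q_{xx}(x,t)$ are integrable on the half-line $\pm x>0$. Write $q=q(x,t)$, $Q=Q(q)$, $Q_\pm=Q(q_\pm)$, $$\Gamma_\pm(z)=\begin{pmatrix}\frac{q_\pm}{q_0}&\frac{q_\pm^\perp}{q_0}&\frac{iq_\pm}{z}\\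 \frac{iq_0}{z}&0&1\end{pmatrix},\qquad(\Gamma_\pm)_{bd}=\begin{pmatrix}\frac{q_\pm}{q_0}&\frac{q_\pm^\perp}{q_0}&0\\0&0&1\end{pmatrix}.$$ Let $R_{\pm,j}\subset\mathbb C\setminus\{0,iq_0,-iq_0\}$ be the union of $\mathbb R\setminus\{0\}$ and of, for $j=1,2,3$ in turn, $\{\pm\mathrm{Im}\,z\le0,\ |z|\le q_0\}$, $\{\pm\mathrm{Im}\,z\ge0\}$, $\{\pm\mathrm{Im}\,z\le0,\ |z|\ge q_0\}$, with the points $0,\pm iq_0$ removed. **Theorem.** For every $j$ and $z\in R_{\pm,j}$ there is exactly one solution $\Phi_{\pm,j}(\cdot,t,z)$ of $\Phi_x=(ik\sigma_3+Q)\Phi$ on $\mathbb R$ such that $\mu_{\pm,j}=\Phi_{\pm,j}e^{-i\Theta_{jj}}$ tends to the $j$-th column of $\Gamma_\pm(z)$ as $x\to\pm\infty$. These are the columns of the Jost eigenfunction $\Phi_\pm$ and of the modified Jost eigenfunction $\mu_\pm=\Phi_\pm e^{-i\Theta}$. For every $x\in\mathbb R$, and for each column $j$ with $z\in R_{\pm,j}$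 (in particular for the whole matrix with $z$ real), $$\mu_\pm(x,t,z)=\begin{pmatrix}\frac{q_\pm}{q_0}&\frac{q_\pm^\perp}{q_0}&\frac{iq}{z}\\ \frac{iq^\dagger q_\pm}{zq_0}&-\frac{iq_\pm^\dagger q^\perp}{zq_0}&1\end{pmatrix}+\frac1z(\Gamma_\pm)_{bd}E_1+O\Big(\frac1{z^2}\Big),\qquad z\to\infty,$$ $$\mu_\pm(x,t,z)=\begin{pmatrix}\frac{q}{q_0}&\frac{q_\pm^\perp}{q_0}&\frac{iq_\pm}{z}\\ \frac{iq_0}{z}&0&\frac{q^\dagger q_\pm}{q_0^2}\end{pmatrix}+(\Gamma_\pm)_{bd}F_0+O(z),\qquad z\to0.$$ Here, with $S_+=\int_x^{\infty}(\Gamma_+)_{bd}^\dagger\,\sigma_3\,(Q(q(y,t))^2-Q_+^2)\,(\Gamma_+)_{bd}\,dy$ and $S_-=\int_{-\infty}^x(\Gamma_-)_{bd}^\dagger\,\sigma_3\,(Q(q(y,t))^2-Q_-^2)\,(\Gamma_-)_{bd}\,dy$, the block-diagonal matrix $E_1$ and the block-off-diagonal matrix $F_0$ (for the splitting $3=2+1$)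 are $$E_1=\pm i\,S_\pm,\qquad F_0=\pm\frac1{q_0}\,S_\pm\begin{pmatrix}0&0&1\\0&0&0\\1&0&0\end{pmatrix}.$$ The constants in the $O$-terms may depend on everything except $z$. -/

import Mathlib

open Filter Topology Matrix Asymptotics

noncomputable section

namespace CMKdV

/-- The space `ℂ²` of values of the potential, with its Euclidean norm. -/
abbrev Pot : Type := EuclideanSpace ℂ (Fin 2)

/-- The two spatial ends; they carry the subscripts `±` of the Jost eigenfunctions. -/
inductive SpatialEnd
  | minus
  | plus

namespace SpatialEnd

/-- `x → -∞` or `x → +∞`. -/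
def filter : SpatialEnd → Filter ℝ
  | minus => atBot
  | plus => atTop

/-- The half-line between `x` and the given end. -/
def ray : SpatialEnd → ℝ → Set ℝ
  | minus, x => Set.Iio x
  | plus, x => Set.Ioi x

/-- The sign `±1`. -/
def sgn : SpatialEnd → ℝ
  | minus => -1
  | plus => 1

end SpatialEnd

/-- `λ(z) = (z + q₀²/z)/2`. -/
def lam (q₀ : ℝ) (z : ℂ) : ℂ := (z + (q₀ : ℂ) ^ 2 / z) / 2

/-- `k(z) = (z - q₀²/z)/2`. -/
def kk (q₀ : ℝ) (z : ℂ) : ℂ := (z - (q₀ : ℂ) ^ 2 / z) / 2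

/-- The orthogonal vector `ω^⊥ = (ω₂, -ω₁)†`. -/
def perp (ω : Pot) : Pot := !₂[star (ω 1), -star (ω 0)]

/-- The Hermitian product `a† b`. -/
def herm (a b : Pot) : ℂ := star (a 0) * b 0 + star (a 1) * b 1

/-- `σ₃ = diag(1, 1, -1)`. -/
def sigma3 : Matrix (Fin 3) (Fin 3) ℂ := Matrix.diagonal ![1, 1, -1]

/-- The block matrix `Q` with upper right block `v` and lower left block `-v†`. -/
def Qmat (v : Pot) : Matrix (Fin 3) (Fin 3) ℂ :=
  !![0, 0, v 0;
     0, 0, v 1;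
     -star (v 0), -star (v 1), 0]

/-- The matrix `U = i k σ₃ + Q` of the scattering problem `Φ_x = U Φ`. -/
def Umat (q₀ : ℝ) (v : Pot) (z : ℂ) : Matrix (Fin 3) (Fin 3) ℂ :=
  (Complex.I * kk q₀ z) • sigma3 + Qmat v

/-- The eigenvector matrix `Γ_±(z)` of `U_±`, where `p = q_±`. -/
def Gam (q₀ : ℝ) (p : Pot) (z : ℂ) : Matrix (Fin 3) (Fin 3) ℂ :=
  !![p 0 / q₀, perp p 0 / q₀, Complex.I * p 0 / z;
     p 1 / q₀, perp p 1 / q₀, Complex.I * p 1 / z;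
     Complex.I * q₀ / z, 0, 1]

/-- The diagonal `(θ₁, θ₂, -θ₁)` of the phase matrix `Θ(x, t, z)`. -/
def theta (q₀ : ℝ) (x t : ℝ) (z : ℂ) : Fin 3 → ℂ :=
  ![lam q₀ z * (x + 2 * (2 * kk q₀ z ^ 2 - (q₀ : ℂ) ^ 2) * t),
    kk q₀ z * (x + 4 * kk q₀ z ^ 2 * t),
    -(lam q₀ z * (x + 2 * (2 * kk q₀ z ^ 2 - (q₀ : ℂ) ^ 2) * t))]

/-- The `j`-th column of the modified eigenfunction `μ = Φ e^{-iΘ}`, where `φ` is the `j`-th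
column of `Φ`. -/
def modify (q₀ : ℝ) (t : ℝ) (z : ℂ) (j : Fin 3) (φ : ℝ → Fin 3 → ℂ) (x : ℝ) : Fin 3 → ℂ :=
  Complex.exp (-(Complex.I * theta q₀ x t z j)) • φ x

/-- `φ` is the `j`-th column of the Jost eigenfunction `Φ_±(·, t, z)`: it solves `φ_x = U φ`, and
`φ e^{-iθ_j}` tends to the `j`-th column of `Γ_±(z)` at the given end. -/
def IsJostColumn (e : SpatialEnd) (q₀ : ℝ) (q : ℝ → ℝ → Pot) (p : Pot) (t : ℝ) (z : ℂ)
    (j : Fin 3) (φ : ℝ → Fin 3 → ℂ) : Prop :=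
  (∀ x, HasDerivAt φ (Umat q₀ (q x t) z *ᵥ φ x) x) ∧
    Tendsto (modify q₀ t z j φ) e.filter (𝓝 fun i => Gam q₀ p z i j)

/-- The set of spectral parameters on which the `j`-th column of `μ_±` lives: the real axis together
with the closure of the column's domain of analyticity, without the singular points `0, ± i q₀`.
For `μ_+` the domains of analyticity of the columns are, in turn, `Im z < 0, |z| < q₀`, then
`Im z > 0`, then `Im z < 0, |z| > q₀`; for `μ_-` they are the complex conjugates of these. -/
def region (e : SpatialEnd) (q₀ : ℝ) (j : Fin 3) : Set ℂ :=
  {z | z ≠ 0 ∧ z ^ 2 ≠ -(q₀ : ℂ) ^ 2 ∧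
    ![z.im = 0 ∨ (e.sgn * z.im ≤ 0 ∧ ‖z‖ ≤ q₀),
      0 ≤ e.sgn * z.im,
      z.im = 0 ∨ (e.sgn * z.im ≤ 0 ∧ q₀ ≤ ‖z‖)] j}

/-- The block-diagonal part `(Γ_±)_bd` of `Γ_±(z)`, which does not depend on `z`. -/
def GamBd (q₀ : ℝ) (p : Pot) : Matrix (Fin 3) (Fin 3) ℂ :=
  !![p 0 / q₀, perp p 0 / q₀, 0;
     p 1 / q₀, perp p 1 / q₀, 0;
     0, 0, 1]

/-- The integral of `(Γ_±)_bd† σ₃ (Q² - Q_±²) (Γ_±)_bd` over the half-line between `x` and the given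
end, entry by entry; a block-diagonal matrix. -/
def bdIntegral (e : SpatialEnd) (q₀ : ℝ) (q : ℝ → ℝ → Pot) (p : Pot) (x t : ℝ) :
    Matrix (Fin 3) (Fin 3) ℂ :=
  Matrix.of fun i j => ∫ y in e.ray x,
    ((GamBd q₀ p)ᴴ * sigma3 * (Qmat (q y t) ^ 2 - Qmat p ^ 2) * GamBd q₀ p) i j

/-- The block-diagonal coefficient `E₁`. -/
def E1 (e : SpatialEnd) (q₀ : ℝ) (q : ℝ → ℝ → Pot) (p : Pot) (x t : ℝ) :
    Matrix (Fin 3) (Fin 3) ℂ :=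
  (e.sgn * Complex.I) • bdIntegral e q₀ q p x t

/-- The block-off-diagonal coefficient `F₀`. -/
def F0 (e : SpatialEnd) (q₀ : ℝ) (q : ℝ → ℝ → Pot) (p : Pot) (x t : ℝ) :
    Matrix (Fin 3) (Fin 3) ℂ :=
  ((e.sgn : ℂ) / q₀) • (bdIntegral e q₀ q p x t * !![0, 0, 1; 0, 0, 0; 1, 0, 0])

/-- The explicit part of the expansion at `z = ∞`; `v = q(x, t)` and `p = q_±`. -/
def leadInf (q₀ : ℝ) (v p : Pot) (z : ℂ) : Matrix (Fin 3) (Fin 3) ℂ :=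
  !![p 0 / q₀, perp p 0 / q₀, Complex.I * v 0 / z;
     p 1 / q₀, perp p 1 / q₀, Complex.I * v 1 / z;
     Complex.I * herm v p / (z * q₀), -(Complex.I * herm p (perp v)) / (z * q₀), 1]

/-- The explicit part of the expansion at `z = 0`; `v = q(x, t)` and `p = q_±`. -/
def leadZero (q₀ : ℝ) (v p : Pot) (z : ℂ) : Matrix (Fin 3) (Fin 3) ℂ :=
  !![v 0 / q₀, perp p 0 / q₀, Complex.I * p 0 / z;
     v 1 / q₀, perp p 1 / q₀, Complex.I * p 1 / z;
     Complex.I * q₀ / z, 0, herm v p / (q₀ : ℂ) ^ 2]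

/-- The nonzero boundary condition at one end, with the decay needed to integrate by parts: `f` tends
to `p`, `(1 + |x|)(f - p)` is integrable near that end, and so are `f'` and `f''`. -/
structure HasBoundaryValue (e : SpatialEnd) (f : ℝ → Pot) (p : Pot) : Prop where
  tendsto : Tendsto f e.filter (𝓝 p)
  integrable_sub : MeasureTheory.IntegrableOn (fun x => (1 + |x|) * ‖f x - p‖) (e.ray 0)
  integrable_deriv : MeasureTheory.IntegrableOn (deriv f) (e.ray 0)
  integrable_deriv_two : MeasureTheory.IntegrableOn (iteratedDeriv 2 f) (e.ray 0)

end CMKdV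

end

noncomputable section

namespace CMKdV

open MeasureTheory

/-! ### The two spatial ends, treated uniformly through their sign. -/

namespace SpatialEnd

/-! Since `∂ₓΘ = diag(λ, k, -λ)`, the column `μ_j = Φ_j e^{-iΘ_j}` satisfies a linear equation in
which `t` enters only through the potential. The matrix `Γ_±` diagonalizes the constant part: `w =
Γ_±⁻¹ μ_j` solves `w' = i D w + Γ_±⁻¹ (Q - Q_±) Γ_± w`, where `D` is diagonal with entries `exponent
i - exponent j`. The region of column `j` is where none of the exponentials `exp(i D (x - y))` grows
as `y` runs from `x` to the end (`exponent_sub_im_nonpos`). On it the Volterra equation with data at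
the end is a contraction in a weighted sup norm, which gives existence
(`exists_hasDerivAt_tendsto`). The same weight gives a Grönwall bound for the inhomogeneous equation
(`norm_le_of_inhomogeneous`), and zero forcing there gives uniqueness
(`existsUnique_isModifiedColumn`).

At `z = ∞` one inserts `X₀ + X₁/z + X₂/z²` into the matrix equation. The leading term `(i z/2)[σ₃,
·]` acts on the block-off-diagonal part only, so each order fixes the next off-diagonal coefficient
algebraically, while the diagonal part of `X₁` comes from integrating an equation in `x`. With `X₀ =
Γ_bd` this yields `X₁ = iσ₃QΓ_bd + Γ_bd E₁`; of `X₂` only the off-diagonal part is needed to make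
the defect `O(1/z²)` (`truncation_defect`). The defect coefficients are integrable towards the end:
this uses the first moment, which makes `E₁` integrable, as well as `q_x` and `q_xx`. As `Γ_±` and
its inverse stay bounded at infinity, the Grönwall bound makes the remainder `O(1/z²)`
(`HasBoundaryValue.exists_expansion_bound`).

The expansion at `z = 0` needs no further analysis. The map `z ↦ -q₀²/z` fixes `k` and negates `λ`,
hence preserves the equation, exchanges the first and third columns up to a factor `i q₀/z`, and
carries regions to regions. The factor raises the remainder `O(z²)` to `O(z)` and turns the `E₁`
term into the constant term `F₀` (`exists_leadZero_bound`). -/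

lemma sgn_mul_sgn (e : SpatialEnd) : e.sgn * e.sgn = 1 := by cases e <;> simp [sgn]

lemma abs_sgn (e : SpatialEnd) : |e.sgn| = 1 := by cases e <;> simp [sgn]

lemma measurableSet_ray (e : SpatialEnd) (x : ℝ) : MeasurableSet (e.ray x) := by
  cases e
  exacts [measurableSet_Iio, measurableSet_Ioi]

lemma ray_mem_filter (e : SpatialEnd) (x : ℝ) : e.ray x ∈ e.filter := by
  cases e
  exacts [Iio_mem_atBot x, Ioi_mem_atTop x]

lemma ray_subset_ray {e : SpatialEnd} {x y : ℝ} (h : y ∈ e.ray x) : e.ray y ⊆ e.ray x := by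
  cases e
  exacts [Set.Iio_subset_Iio (le_of_lt h), Set.Ioi_subset_Ioi (le_of_lt h)]

/-- A point of the ray lies farther towards the end than its origin. -/
lemma sgn_mul_sub_nonpos {e : SpatialEnd} {x y : ℝ} (h : y ∈ e.ray x) :
    e.sgn * (x - y) ≤ 0 := by
  cases e <;> simp only [ray, sgn, Set.mem_Iio, Set.mem_Ioi] at h ⊢ <;> linarith

end SpatialEnd

/-! ### Integrals from a point to an end of the line. -/

section Ray

variable {E : Type*} [NormedAddCommGroup E] {e : SpatialEnd}

lemma _root_.Continuous.integrableOn_ray {h : ℝ → E} (hc : Continuous h) {a : ℝ}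
    (hi : IntegrableOn h (e.ray a)) (x : ℝ) : IntegrableOn h (e.ray x) := by
  cases e
  · refine (hi.union (hc.integrableOn_Icc (a := a) (b := x))).mono_set fun y hy => ?_
    rcases lt_or_ge y a with h | h
    exacts [Or.inl h, Or.inr ⟨h, le_of_lt hy⟩]
  · refine (hi.union (hc.integrableOn_Icc (a := x) (b := a))).mono_set fun y hy => ?_
    rcases lt_or_ge a y with h | h
    exacts [Or.inl h, Or.inr ⟨le_of_lt hy, h⟩]

lemma exists_bound_of_tendsto {g : ℝ → E} (hc : Continuous g) {L : E}
    (hl : Tendsto g e.filter (𝓝 L)) (x : ℝ) :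
    ∃ K, 0 ≤ K ∧ ∀ y ∈ insert x (e.ray x), ‖g y‖ ≤ K := by
  have hev : ∀ᶠ y in e.filter, ‖g y‖ < ‖L‖ + 1 :=
    hl.norm.eventually (gt_mem_nhds (by linarith))
  obtain ⟨a, ha⟩ : ∃ a, ∀ y ∈ insert x (e.ray x), y ∉ Set.uIcc a x → ‖g y‖ < ‖L‖ + 1 := by
    cases e
    · obtain ⟨a, ha⟩ := eventually_atBot.1 hev
      refine ⟨a, fun y hy hn => ha y ?_⟩
      have hy' : y ≤ x := by rcases hy with rfl | h; exacts [le_rfl, le_of_lt h]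
      by_contra! h
      exact hn (Set.mem_uIcc.2 (Or.inl ⟨h.le, hy'⟩))
    · obtain ⟨a, ha⟩ := eventually_atTop.1 hev
      refine ⟨a, fun y hy hn => ha y ?_⟩
      have hy' : x ≤ y := by rcases hy with rfl | h; exacts [le_rfl, le_of_lt h]
      by_contra! h
      exact hn (Set.mem_uIcc.2 (Or.inr ⟨hy', h.le⟩))
  obtain ⟨K, hK⟩ := (isCompact_uIcc (a := a) (b := x)).exists_bound_of_continuousOn hc.continuousOn
  refine ⟨max K (‖L‖ + 1), le_max_of_le_right (by positivity), fun y hy => ?_⟩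
  by_cases hm : y ∈ Set.uIcc a x
  · exact (hK y hm).trans (le_max_left _ _)
  · exact (ha y hy hm).le.trans (le_max_right _ _)

variable [NormedSpace ℝ E]

/-- The integral of `h` between `x` and the given end. -/
def tail (e : SpatialEnd) (h : ℝ → E) (x : ℝ) : E := ∫ y in e.ray x, h y

lemma tail_eq_of_hasDerivAt [CompleteSpace E] {g h : ℝ → E} {L : E} {x : ℝ}
    (hd : ∀ y, HasDerivAt g (h y) y)
    (hi : IntegrableOn h (e.ray x)) (hl : Tendsto g e.filter (𝓝 L)) :
    tail e h x = e.sgn • (L - g x) := by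
  cases e
  · have := integral_Iic_of_hasDerivAt_of_tendsto (a := x) (hd x).continuousAt.continuousWithinAt
      (fun y _ => hd y) ((integrableOn_Iic_iff_integrableOn_Iio).2 hi) hl
    rw [tail, SpatialEnd.ray, ← integral_Iic_eq_integral_Iio, this]
    simp [SpatialEnd.sgn]
  · have := integral_Ioi_of_hasDerivAt_of_tendsto (a := x) (hd x).continuousAt.continuousWithinAt
      (fun y _ => hd y) hi hl
    rw [tail, SpatialEnd.ray, this]
    simp [SpatialEnd.sgn]

/-- The moving endpoint is the inner one, so the integral decreases towards `+∞` and increases away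
from `-∞`; hence the factor `-sgn`. -/
lemma hasDerivAt_tail [CompleteSpace E] {h : ℝ → E} (hc : Continuous h) {a : ℝ}
    (hi : IntegrableOn h (e.ray a)) (x : ℝ) :
    HasDerivAt (tail e h) (-(e.sgn • h x)) x := by
  have hi' := hc.integrableOn_ray hi
  have hd : HasDerivAt (fun y => ∫ s in x..y, h s) (h x) x := hc.integral_hasStrictDerivAt x x |>.hasDerivAt
  cases e
  · have hE : tail SpatialEnd.minus h =
        fun y => tail SpatialEnd.minus h x + ∫ s in x..y, h s := by
      funext y
      have := intervalIntegral.integral_Iic_sub_Iic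
        ((integrableOn_Iic_iff_integrableOn_Iio).2 (hi' x))
        ((integrableOn_Iic_iff_integrableOn_Iio).2 (hi' y))
      rw [← this]
      simp only [tail, SpatialEnd.ray, integral_Iic_eq_integral_Iio]
      abel
    rw [hE]
    simpa [SpatialEnd.sgn] using hd.const_add (tail SpatialEnd.minus h x)
  · have hE : tail SpatialEnd.plus h =
        fun y => tail SpatialEnd.plus h x - ∫ s in x..y, h s := by
      funext y
      have := intervalIntegral.integral_interval_add_Ioi (hi' x) (hi' y)
      simp only [tail, SpatialEnd.ray]
      rw [← this]
      abel
    rw [hE]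
    simpa [SpatialEnd.sgn] using hd.const_sub (tail SpatialEnd.plus h x)

lemma tendsto_tail_zero {h : ℝ → E} (e : SpatialEnd) :
    Tendsto (tail e h) e.filter (𝓝 0) := by
  cases e
  · exact tendsto_integral_Iio_zero (a := id) (l := atBot) tendsto_id
  · exact tendsto_integral_Ioi_zero (b := id) (l := atTop) tendsto_id

lemma tendsto_zero_of_integrableOn_ray {g h : ℝ → E}
    (hd : ∀ y, HasDerivAt g (h y) y) {a : ℝ}
    (hh : IntegrableOn h (e.ray a)) (hg : IntegrableOn g (e.ray a)) :
    Tendsto g e.filter (𝓝 0) := by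
  cases e
  · exact tendsto_zero_of_hasDerivAt_of_integrableOn_Iic (fun y _ => hd y)
      ((integrableOn_Iic_iff_integrableOn_Iio).2 hh) ((integrableOn_Iic_iff_integrableOn_Iio).2 hg)
  · exact tendsto_zero_of_hasDerivAt_of_integrableOn_Ioi (fun y _ => hd y) hh hg

lemma norm_tail_le {h : ℝ → E} {ρ : ℝ → ℝ} {x : ℝ} (hρ : IntegrableOn ρ (e.ray x))
    (hle : ∀ y ∈ e.ray x, ‖h y‖ ≤ ρ y) : ‖tail e h x‖ ≤ tail e ρ x :=
  norm_integral_le_of_norm_le hρ ((ae_restrict_iff' (e.measurableSet_ray x)).2 (.of_forall hle))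

lemma tail_mono {f g : ℝ → ℝ} {x : ℝ} (hf : IntegrableOn f (e.ray x))
    (hg : IntegrableOn g (e.ray x)) (hle : ∀ y ∈ e.ray x, f y ≤ g y) : tail e f x ≤ tail e g x :=
  setIntegral_mono_on hf hg (e.measurableSet_ray x) hle

lemma tail_nonneg {f : ℝ → ℝ} {x : ℝ} (hf : ∀ y ∈ e.ray x, 0 ≤ f y) : 0 ≤ tail e f x :=
  setIntegral_nonneg (e.measurableSet_ray x) hf

lemma tail_le_of_mem {f : ℝ → ℝ} {x y : ℝ} (hi : IntegrableOn f (e.ray x))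
    (hf : ∀ s ∈ e.ray x, 0 ≤ f s) (hy : y ∈ e.ray x) : tail e f y ≤ tail e f x :=
  setIntegral_mono_set hi ((ae_restrict_iff' (e.measurableSet_ray x)).2 (.of_forall hf))
    (SpatialEnd.ray_subset_ray hy).eventuallyLE

/-- The tail of a nonnegative function with a finite first moment is integrable. -/
lemma integrableOn_tail_of_moment {δ : ℝ → ℝ} (hc : Continuous δ) (h0 : ∀ y, 0 ≤ δ y)
    (hi : IntegrableOn (fun y => (1 + |y|) * δ y) (e.ray 0)) :
    IntegrableOn (tail e δ) (e.ray 0) := by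
  have hcK : Continuous fun y => (1 + |y|) * δ y := by fun_prop
  have hδ : IntegrableOn δ (e.ray 0) := by
    refine Integrable.mono' hi hc.aestronglyMeasurable (.of_forall fun y => ?_)
    rw [Real.norm_of_nonneg (h0 y)]
    nlinarith [h0 y, abs_nonneg y]
  have hdτ := hasDerivAt_tail hc hδ
  have hiK := hcK.integrableOn_ray hi
  have hK0 := tendsto_tail_zero (h := fun y => (1 + |y|) * δ y) e
  -- Beyond `x` one has `|x| ≤ |y|`, so the weight may be moved inside the integral. This forces the
  -- boundary term of the integration by parts to vanish at the end.
  have hle : ∀ x ∈ e.ray 0, (1 + |x|) * tail e δ x ≤ tail e (fun y => (1 + |y|) * δ y) x := by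
    intro x hx
    have : (1 + |x|) * tail e δ x = tail e (fun y => (1 + |x|) * δ y) x :=
      (integral_const_mul _ _).symm
    rw [this]
    refine tail_mono ((hc.integrableOn_ray hδ x).const_mul _) (hiK x) fun y hy => ?_
    refine mul_le_mul_of_nonneg_right ?_ (h0 y)
    cases e
    · rw [abs_of_neg (show x < 0 from hx), abs_of_neg (lt_trans hy hx : y < 0)]
      linarith [show y < x from hy]
    · rw [abs_of_pos (show 0 < x from hx), abs_of_pos (lt_trans hx hy : 0 < y)]
      linarith [show x < y from hy]
  have hτ0 : ∀ x, 0 ≤ tail e δ x := fun x => tail_nonneg fun y _ => h0 y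
  have hsq : Tendsto (fun x => (1 + |x|) * tail e δ x) e.filter (𝓝 0) :=
    tendsto_of_tendsto_of_tendsto_of_le_of_le' tendsto_const_nhds hK0
      (.of_forall fun x => mul_nonneg (by positivity) (hτ0 x))
      (Filter.mem_of_superset (e.ray_mem_filter 0) hle)
  -- Integration by parts: with `τ = tail e δ`, the function `(1 + sgn x) τ(x)` minus the tail of
  -- the weighted `δ` has derivative `sgn τ` on the closed ray, the two `δ` terms cancelling because
  -- `|x| = sgn x` there. It tends to `0`, and a derivative of constant sign with convergent
  -- antiderivative is integrable.
  have hder : ∀ x, HasDerivAt (fun y => (1 + e.sgn * y) * tail e δ y)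
      (e.sgn * tail e δ x + (1 + e.sgn * x) * -(e.sgn * δ x)) x := by
    intro x
    have h1 : HasDerivAt (fun y => 1 + e.sgn * y) e.sgn x := by
      simpa using ((hasDerivAt_id x).const_mul e.sgn).const_add 1
    exact h1.mul (hdτ x)
  have hsum : Tendsto (fun x => (1 + e.sgn * x) * tail e δ x -
      tail e (fun y => (1 + |y|) * δ y) x) e.filter (𝓝 0) := by
    rw [← sub_zero (0 : ℝ)]
    refine (hsq.congr' ?_).sub hK0
    filter_upwards [e.ray_mem_filter 0] with x hx
    cases e
    · rw [abs_of_neg (show x < 0 from hx), SpatialEnd.sgn, neg_one_mul]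
    · rw [abs_of_pos (show 0 < x from hx), SpatialEnd.sgn, one_mul]
  have hdH : ∀ x ∈ insert 0 (e.ray 0), HasDerivAt (fun x => (1 + e.sgn * x) * tail e δ x -
      tail e (fun y => (1 + |y|) * δ y) x) (e.sgn * tail e δ x) x := by
    intro x hx
    refine ((hder x).sub (hasDerivAt_tail hcK hi x)).congr_deriv ?_
    have : |x| = e.sgn * x := by
      cases e
      · rcases hx with rfl | hx
        · simp
        · rw [abs_of_neg (show x < 0 from hx), SpatialEnd.sgn, neg_one_mul]
      · rcases hx with rfl | hx
        · simp
        · rw [abs_of_pos (show 0 < x from hx), SpatialEnd.sgn, one_mul]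
    rw [this, smul_eq_mul]
    ring
  cases e
  -- The end `-∞` is reduced to `+∞` by the reflection `x ↦ -x`.
  · have key : IntegrableOn (fun y => tail SpatialEnd.minus δ (-y)) (Set.Ioi 0) := by
      refine integrableOn_Ioi_deriv_of_nonneg' (fun x hx => ?_) (fun x _ => hτ0 (-x))
        (hsum.comp tendsto_neg_atTop_atBot)
      have hx' : -x ∈ insert 0 (SpatialEnd.minus.ray 0) := by
        rcases eq_or_lt_of_le (show 0 ≤ x from hx) with h | h
        exacts [Or.inl (by rw [← h, neg_zero]), Or.inr (neg_lt_zero.2 h)]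
      simpa [SpatialEnd.sgn] using (hdH (-x) hx').scomp x (hasDerivAt_neg x)
    rw [← neg_zero] at key
    have := key.comp_neg_Iio
    simp only [neg_neg] at this
    exact this
  · refine integrableOn_Ioi_deriv_of_nonneg' (fun x hx => ?_) (fun x _ => hτ0 x) hsum
    have := hdH x (by
      rcases eq_or_lt_of_le (show 0 ≤ x from hx) with h | h
      exacts [Or.inl h.symm, Or.inr h])
    simpa [SpatialEnd.sgn] using this

end Ray

/-! ### Grönwall's inequality and a priori bounds with data at an end. -/

section Volterra

attribute [local instance] Matrix.linftyOpNormedRing Matrix.linftyOpNormedAlgebra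
  Matrix.linftyOpNormedAddCommGroup Matrix.linftyOpNormedSpace

variable {e : SpatialEnd} {ι : Type*} [Fintype ι]

lemma hasDerivAt_exp_two_tail {b : ℝ → ℝ} (hb : Continuous b) {a : ℝ}
    (hbi : IntegrableOn b (e.ray a)) (x : ℝ) :
    HasDerivAt (fun y => Real.exp (2 * tail e b y))
      (Real.exp (2 * tail e b x) * (2 * -(e.sgn * b x))) x :=
  ((hasDerivAt_tail hb hbi x).const_mul 2).exp

lemma integrableOn_mul_exp_two_tail {b : ℝ → ℝ} (hb : Continuous b) (hb0 : ∀ y, 0 ≤ b y) {a : ℝ}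
    (hbi : IntegrableOn b (e.ray a)) (x : ℝ) :
    IntegrableOn (fun y => b y * Real.exp (2 * tail e b y)) (e.ray x) := by
  have hi := hb.integrableOn_ray hbi x
  have hct : Continuous fun y => Real.exp (2 * tail e b y) :=
    continuous_iff_continuousAt.2 fun y => (hasDerivAt_exp_two_tail hb hbi y).continuousAt
  refine Integrable.mono' (hi.mul_const (Real.exp (2 * tail e b x)))
    (hb.mul hct).aestronglyMeasurable ((ae_restrict_iff' (e.measurableSet_ray x)).2
      (.of_forall fun y hy => ?_))
  rw [Real.norm_of_nonneg (mul_nonneg (hb0 y) (Real.exp_pos _).le)]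
  have := tail_le_of_mem hi (fun s _ => hb0 s) hy
  gcongr
  exact hb0 y

/-- Up to a constant the integrand is the derivative of the weight. The factor `2` in the exponent
makes the integral at most half the weight: this is the source of the gain `N / 2` in Grönwall's
inequality and of the contraction constant `1 / 2`. -/
lemma tail_mul_exp_two_tail {b : ℝ → ℝ} (hb : Continuous b) (hb0 : ∀ y, 0 ≤ b y) {a : ℝ}
    (hbi : IntegrableOn b (e.ray a)) (x : ℝ) :
    tail e (fun y => b y * Real.exp (2 * tail e b y)) x = (Real.exp (2 * tail e b x) - 1) / 2 := by
  have hl : Tendsto (fun y => (-e.sgn / 2) * Real.exp (2 * tail e b y)) e.filter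
      (𝓝 ((-e.sgn / 2) * Real.exp (2 * 0))) :=
    (Real.continuous_exp.continuousAt.tendsto.comp
      ((tendsto_tail_zero e).const_mul 2)).const_mul _
  rw [tail_eq_of_hasDerivAt (g := fun y => (-e.sgn / 2) * Real.exp (2 * tail e b y)) (fun y => ?_)
    (integrableOn_mul_exp_two_tail hb hb0 hbi x) hl]
  · rw [mul_zero, Real.exp_zero, smul_eq_mul]
    linear_combination (Real.exp (2 * tail e b x) - 1) / 2 * e.sgn_mul_sgn
  · refine ((hasDerivAt_exp_two_tail hb hbi y).const_mul _).congr_deriv ?_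
    linear_combination (Real.exp (2 * tail e b y)) * b y * e.sgn_mul_sgn

/-- Grönwall's inequality with data at one end of the line. -/
lemma le_two_mul_exp_of_le_tail {f b : ℝ → ℝ} (hf : Continuous f) (hf0 : ∀ y, 0 ≤ f y)
    (hb : Continuous b) (hb0 : ∀ y, 0 ≤ b y) {a : ℝ} (hbi : IntegrableOn b (e.ray a))
    {x K M : ℝ} (hK : 0 ≤ K) (hM : ∀ y ∈ insert x (e.ray x), f y ≤ M)
    (h : ∀ y ∈ insert x (e.ray x), f y ≤ tail e (fun s => b s * f s) y + K) :
    f x ≤ 2 * K * Real.exp (2 * tail e b x) := by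
  set S := insert x (e.ray x)
  -- Dividing by the weight `exp(2 tail b)`, the supremum `N` of the quotient on the closed ray is
  -- finite because `f` is bounded there; the hypothesis then gives `N ≤ K + N / 2`, so `N ≤ 2K`.
  set g : ℝ → ℝ := fun y => f y * Real.exp (-(2 * tail e b y))
  have hτ : ∀ y, 0 ≤ tail e b y := fun y => tail_nonneg fun s _ => hb0 s
  have hexp : ∀ y, Real.exp (-(2 * tail e b y)) ≤ 1 := fun y =>
    Real.exp_le_one_iff.2 (by linarith [hτ y])
  have hxS : x ∈ S := Set.mem_insert _ _
  have hbdd : BddAbove (g '' S) := by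
    refine ⟨M, ?_⟩
    rintro _ ⟨y, hy, rfl⟩
    exact (mul_le_of_le_one_right (hf0 y) (hexp y)).trans (hM y hy)
  set N := sSup (g '' S)
  have hgN : ∀ y ∈ S, g y ≤ N := fun y hy => le_csSup hbdd ⟨y, hy, rfl⟩
  have hN0 : 0 ≤ N := (mul_nonneg (hf0 x) (Real.exp_pos _).le).trans (hgN x hxS)
  have hfN : ∀ y ∈ S, f y ≤ N * Real.exp (2 * tail e b y) := by
    intro y hy
    have := mul_le_mul_of_nonneg_right (hgN y hy) (Real.exp_pos (2 * tail e b y)).le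
    rwa [mul_assoc, ← Real.exp_add, neg_add_cancel, Real.exp_zero, mul_one] at this
  have hsub : ∀ y ∈ S, e.ray y ⊆ S := by
    rintro y (rfl | hy)
    · exact Set.subset_insert _ _
    · exact (SpatialEnd.ray_subset_ray hy).trans (Set.subset_insert _ _)
  have hstep : ∀ y ∈ S, g y ≤ K + N / 2 := by
    intro y hy
    have hi := integrableOn_mul_exp_two_tail hb hb0 hbi y
    have h1 : tail e (fun s => b s * f s) y ≤
        tail e (fun s => N * (b s * Real.exp (2 * tail e b s))) y := by
      refine tail_mono ?_ (hi.const_mul N) fun s hs => ?_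
      · refine Integrable.mono' (hi.const_mul N) (hb.mul hf).aestronglyMeasurable
          ((ae_restrict_iff' (e.measurableSet_ray y)).2 (.of_forall fun s hs => ?_))
        rw [Real.norm_of_nonneg (mul_nonneg (hb0 s) (hf0 s))]
        nlinarith [hfN s (hsub y hy hs), hb0 s]
      · nlinarith [hfN s (hsub y hy hs), hb0 s]
    have h2 : tail e (fun s => N * (b s * Real.exp (2 * tail e b s))) y =
        N * ((Real.exp (2 * tail e b y) - 1) / 2) := by
      rw [← tail_mul_exp_two_tail hb hb0 hbi y]
      exact integral_const_mul _ _
    have h3 : f y ≤ N / 2 * Real.exp (2 * tail e b y) + K := by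
      nlinarith [h y hy]
    calc g y ≤ (N / 2 * Real.exp (2 * tail e b y) + K) * Real.exp (-(2 * tail e b y)) :=
          mul_le_mul_of_nonneg_right h3 (Real.exp_pos _).le
      _ = N / 2 * Real.exp (2 * tail e b y + -(2 * tail e b y)) +
          K * Real.exp (-(2 * tail e b y)) := by rw [Real.exp_add]; ring
      _ ≤ K + N / 2 := by
          rw [add_neg_cancel, Real.exp_zero]
          nlinarith [hexp y]
  have hN : N ≤ K + N / 2 := by
    refine csSup_le ⟨_, x, hxS, rfl⟩ ?_
    rintro _ ⟨y, hy, rfl⟩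
    exact hstep y hy
  refine (hfN x hxS).trans ?_
  gcongr
  linarith

/-- The modulus is `exp(-Im d · (x - y))`, and `x - y` has the sign opposite to that of the end. -/
lemma norm_cexp_le_one {e : SpatialEnd} {d : ℂ} (hd : e.sgn * d.im ≤ 0) {x y : ℝ}
    (hy : y ∈ e.ray x) : ‖Complex.exp (Complex.I * d * x) * Complex.exp (-(Complex.I * d * y))‖ ≤ 1 := by
  rw [← Complex.exp_add, Complex.norm_exp]
  refine Real.exp_le_one_iff.2 ?_
  have h2 : (Complex.I * d * x + -(Complex.I * d * y)).re = -d.im * (x - y) := by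
    simp
    ring
  have h3 := SpatialEnd.sgn_mul_sub_nonpos hy
  rw [h2]
  cases e <;> simp only [SpatialEnd.sgn] at hd h3 <;> nlinarith

lemma hasDerivAt_cexp_mul (d : ℂ) (x : ℝ) :
    HasDerivAt (fun y : ℝ => Complex.exp (Complex.I * d * y))
      (Complex.exp (Complex.I * d * x) * (Complex.I * d)) x := by
  have : HasDerivAt (fun y : ℝ => Complex.I * d * (y : ℂ)) (Complex.I * d) x := by
    simpa using (Complex.ofRealCLM.hasDerivAt (x := x)).const_mul (Complex.I * d)
  exact this.cexp

lemma hasDerivAt_cexp_neg_mul (d : ℂ) (x : ℝ) :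
    HasDerivAt (fun y : ℝ => Complex.exp (-(Complex.I * d * y)))
      (-(Complex.exp (-(Complex.I * d * x)) * (Complex.I * d))) x := by
  have := hasDerivAt_cexp_mul (-d) x
  simpa [mul_neg, neg_mul] using this

/-- The size of a solution of `r' = i D r + g` that vanishes at an end towards which the
exponentials `exp (-i D x)` do not grow. -/
theorem norm_le_of_hasDerivAt {D : ι → ℂ} (hD : ∀ i, e.sgn * (D i).im ≤ 0)
    {r g : ℝ → ι → ℂ} (hg : Continuous g)
    (hr : ∀ x, HasDerivAt r (Complex.I • (D * r x) + g x) x)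
    (hr0 : Tendsto r e.filter (𝓝 0))
    {b ρ : ℝ → ℝ} (hb : Continuous b) (hb0 : ∀ y, 0 ≤ b y) {a : ℝ} (hbi : IntegrableOn b (e.ray a))
    {x : ℝ} (hρi : IntegrableOn ρ (e.ray x)) (hρ0 : ∀ y, 0 ≤ ρ y)
    (hle : ∀ y ∈ e.ray x, ‖g y‖ ≤ b y * ‖r y‖ + ρ y) :
    ‖r x‖ ≤ 2 * tail e ρ x * Real.exp (2 * tail e b x) := by
  have hrc : Continuous r := continuous_iff_continuousAt.2 fun y => (hr y).continuousAt
  obtain ⟨M, hM0, hM⟩ := exists_bound_of_tendsto hrc hr0 x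
  have hsub : ∀ y ∈ insert x (e.ray x), e.ray y ⊆ e.ray x := by
    rintro y (rfl | hy)
    exacts [subset_rfl, SpatialEnd.ray_subset_ray hy]
  have hbr : IntegrableOn (fun s => b s * ‖r s‖) (e.ray x) := by
    refine Integrable.mono' ((hb.integrableOn_ray hbi x).mul_const M)
      (hb.mul hrc.norm).aestronglyMeasurable ((ae_restrict_iff' (e.measurableSet_ray x)).2
        (.of_forall fun s hs => ?_))
    rw [Real.norm_of_nonneg (mul_nonneg (hb0 s) (norm_nonneg _))]
    exact mul_le_mul_of_nonneg_left (hM s (Set.mem_insert_of_mem _ hs)) (hb0 s)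
  refine le_two_mul_exp_of_le_tail hrc.norm (fun y => norm_nonneg _) hb hb0 hbi
    (tail_nonneg fun y _ => hρ0 y) hM fun y hy => ?_
  have hgi : IntegrableOn g (e.ray y) := by
    refine Integrable.mono' ((hbr.add hρi).mono_set (hsub y hy)) hg.aestronglyMeasurable
      ((ae_restrict_iff' (e.measurableSet_ray y)).2 (.of_forall fun s hs => hle s (hsub y hy hs)))
  have hρy : tail e ρ y ≤ tail e ρ x := by
    rcases hy with rfl | hy
    exacts [le_rfl, tail_le_of_mem hρi (fun s _ => hρ0 s) hy]
  have hbr' := hbr.mono_set (hsub y hy)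
  have hρ' := hρi.mono_set (hsub y hy)
  refine le_trans ?_ (add_le_add_right hρy _)
  have hadd : tail e (fun s => b s * ‖r s‖) y + tail e ρ y =
      tail e (fun s => b s * ‖r s‖ + ρ s) y := (integral_add hbr' hρ').symm
  rw [hadd]
  refine (pi_norm_le_iff_of_nonneg (tail_nonneg fun s _ =>
    add_nonneg (mul_nonneg (hb0 s) (norm_nonneg _)) (hρ0 s))).2 fun i => ?_
  -- Integrating factor, normalized by `E y = 1`. As `|E| ≤ 1` on the ray and `r` vanishes at the
  -- end, integrating `(E r_i)' = E g_i` expresses `r_i(y)` by the tail of `E g_i` alone.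
  set E : ℝ → ℂ := fun s => Complex.exp (Complex.I * D i * y) * Complex.exp (-(Complex.I * D i * s))
  have hEd : ∀ s, HasDerivAt E (-(E s * (Complex.I * D i))) s := fun s =>
    ((hasDerivAt_cexp_neg_mul (D i) s).const_mul _).congr_deriv (by simp only [E]; ring)
  have hE1 : ∀ s ∈ e.ray y, ‖E s‖ ≤ 1 := fun s hs => norm_cexp_le_one (hD i) hs
  have hEy : E y = 1 := by
    simp only [E]
    rw [← Complex.exp_add, add_neg_cancel, Complex.exp_zero]
  have hEc : Continuous E := continuous_iff_continuousAt.2 fun s => (hEd s).continuousAt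
  have hd : ∀ s, HasDerivAt (fun s => E s * r s i) (E s * g s i) s := fun s =>
    ((hEd s).mul (hasDerivAt_pi.1 (hr s) i)).congr_deriv (by simp; ring)
  have hgle : ∀ s ∈ e.ray y, ‖E s * g s i‖ ≤ b s * ‖r s‖ + ρ s := fun s hs => by
    rw [norm_mul]
    calc ‖E s‖ * ‖g s i‖ ≤ 1 * ‖g s‖ := by
          gcongr
          exacts [hE1 s hs, norm_le_pi_norm (g s) i]
      _ ≤ _ := by rw [one_mul]; exact hle s (hsub y hy hs)
  have hi : IntegrableOn (fun s => E s * g s i) (e.ray y) :=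
    Integrable.mono' (hbr'.add hρ') (hEc.mul ((continuous_apply i).comp hg)).aestronglyMeasurable
      ((ae_restrict_iff' (e.measurableSet_ray y)).2 (.of_forall hgle))
  have hlim : Tendsto (fun s => E s * r s i) e.filter (𝓝 0) := by
    refine squeeze_zero_norm' (a := fun s => ‖r s‖) ?_ (by simpa using hr0.norm)
    filter_upwards [e.ray_mem_filter y] with s hs
    rw [norm_mul]
    calc ‖E s‖ * ‖r s i‖ ≤ 1 * ‖r s‖ := by
          gcongr
          exacts [hE1 s hs, norm_le_pi_norm (r s) i]
      _ = _ := one_mul _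
  have hkey := tail_eq_of_hasDerivAt hd hi hlim
  have : ‖r y i‖ = ‖tail e (fun s => E s * g s i) y‖ := by
    rw [hkey, zero_sub, hEy, one_mul, norm_smul, norm_neg, Real.norm_eq_abs, e.abs_sgn, one_mul]
  rw [this]
  exact norm_tail_le (hbr'.add hρ') hgle

end Volterra

/-! ### Existence by a contraction in a weighted sup norm. -/

section VolterraExistence

attribute [local instance] Matrix.linftyOpNormedRing Matrix.linftyOpNormedAlgebra
  Matrix.linftyOpNormedAddCommGroup Matrix.linftyOpNormedSpace

variable {e : SpatialEnd} {ι : Type*} [Fintype ι]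

/-- The Volterra operator with data at the end `e` that belongs to `w' = i D w + B w`. -/
def volterra (e : SpatialEnd) (D : ι → ℂ) (B : ℝ → Matrix ι ι ℂ) (w : ℝ → ι → ℂ) (x : ℝ) :
    ι → ℂ := fun i =>
  (e.sgn : ℂ) * (Complex.exp (Complex.I * D i * x) *
    tail e (fun y => Complex.exp (-(Complex.I * D i * y)) * (B y *ᵥ w y) i) x)

variable {D : ι → ℂ} {B : ℝ → Matrix ι ι ℂ} {w : ℝ → ι → ℂ}

lemma continuous_mulVec_apply (hB : Continuous B) (hw : Continuous w) (i : ι) :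
    Continuous fun y => (B y *ᵥ w y) i :=
  (continuous_apply i).comp (hB.matrix_mulVec hw)

lemma continuous_volterra_kernel (hB : Continuous B) (hw : Continuous w) (d : ℂ) (i : ι) :
    Continuous fun y : ℝ => Complex.exp (-(Complex.I * d * y)) * (B y *ᵥ w y) i := by
  have := continuous_mulVec_apply hB hw i
  fun_prop

lemma norm_volterra_kernel_le (hD : ∀ i, e.sgn * (D i).im ≤ 0) (i : ι) {x y : ℝ}
    (hy : y ∈ e.ray x) :
    ‖Complex.exp (Complex.I * D i * x) *
      (Complex.exp (-(Complex.I * D i * y)) * (B y *ᵥ w y) i)‖ ≤ ‖B y‖ * ‖w y‖ := by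
  rw [← mul_assoc, norm_mul]
  calc _ ≤ 1 * ‖B y *ᵥ w y‖ := by
        gcongr
        exacts [norm_cexp_le_one (hD i) hy, norm_le_pi_norm _ i]
    _ ≤ ‖B y‖ * ‖w y‖ := by
        rw [one_mul]
        exact Matrix.linfty_opNorm_mulVec _ _

lemma integrableOn_volterra_kernel (hD : ∀ i, e.sgn * (D i).im ≤ 0) (hB : Continuous B)
    (hw : Continuous w) {x : ℝ} (hi : IntegrableOn (fun y => ‖B y‖ * ‖w y‖) (e.ray x)) (i : ι) :
    IntegrableOn (fun y : ℝ => Complex.exp (-(Complex.I * D i * y)) * (B y *ᵥ w y) i) (e.ray x) := by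
  have : IntegrableOn (fun y : ℝ => Complex.exp (Complex.I * D i * x) *
      (Complex.exp (-(Complex.I * D i * y)) * (B y *ᵥ w y) i)) (e.ray x) :=
    Integrable.mono' hi
      ((continuous_volterra_kernel hB hw (D i) i).const_mul _).aestronglyMeasurable
      ((ae_restrict_iff' (e.measurableSet_ray x)).2
        (.of_forall fun y hy => norm_volterra_kernel_le hD i hy))
  exact (integrable_const_mul_iff (isUnit_iff_ne_zero.2 (Complex.exp_ne_zero _)) _).1 this

lemma norm_volterra_le (hD : ∀ i, e.sgn * (D i).im ≤ 0) {x : ℝ}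
    (hi : IntegrableOn (fun y => ‖B y‖ * ‖w y‖) (e.ray x)) :
    ‖volterra e D B w x‖ ≤ tail e (fun y => ‖B y‖ * ‖w y‖) x := by
  refine (pi_norm_le_iff_of_nonneg (tail_nonneg fun s _ => by positivity)).2 fun i => ?_
  rw [volterra, norm_mul, Complex.norm_real, Real.norm_eq_abs, e.abs_sgn, one_mul, tail,
    ← integral_const_mul]
  exact norm_tail_le hi fun y hy => norm_volterra_kernel_le hD i hy

/-- The sign of the `B` term is such that a fixed point `w = c - volterra e D B w` with `D c = 0`
solves `w' = i D w + B w`. -/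
lemma hasDerivAt_volterra (hD : ∀ i, e.sgn * (D i).im ≤ 0) (hB : Continuous B)
    (hw : Continuous w) {a : ℝ} (hi : IntegrableOn (fun y => ‖B y‖ * ‖w y‖) (e.ray a)) (x : ℝ) :
    HasDerivAt (volterra e D B w)
      (Complex.I • (D * volterra e D B w x) - B x *ᵥ w x) x := by
  refine hasDerivAt_pi.2 fun i => ?_
  have h1 := hasDerivAt_tail (continuous_volterra_kernel hB hw (D i) i)
    (integrableOn_volterra_kernel hD hB hw hi i) x
  have h2 := ((hasDerivAt_cexp_mul (D i) x).mul h1).const_mul (e.sgn : ℂ)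
  refine h2.congr_deriv ?_
  have hs : (e.sgn : ℂ) * e.sgn = 1 := by exact_mod_cast e.sgn_mul_sgn
  have hE : Complex.exp (Complex.I * D i * x) * Complex.exp (-(Complex.I * D i * x)) = 1 := by
    rw [← Complex.exp_add, add_neg_cancel, Complex.exp_zero]
  simp only [volterra, Pi.sub_apply, Pi.smul_apply, Pi.mul_apply, smul_eq_mul,
    Complex.real_smul]
  linear_combination (-(B x *ᵥ w x) i) * hs - (e.sgn : ℂ) * e.sgn * (B x *ᵥ w x) i * hE

lemma volterra_sub (hD : ∀ i, e.sgn * (D i).im ≤ 0) (hB : Continuous B) {w' : ℝ → ι → ℂ}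
    (hw : Continuous w) (hw' : Continuous w') {x : ℝ}
    (hi : IntegrableOn (fun y => ‖B y‖ * ‖w y‖) (e.ray x))
    (hi' : IntegrableOn (fun y => ‖B y‖ * ‖w' y‖) (e.ray x)) :
    volterra e D B w x - volterra e D B w' x = volterra e D B (fun y => w y - w' y) x := by
  funext i
  simp only [volterra, Pi.sub_apply]
  rw [← mul_sub, ← mul_sub]
  congr 2
  simp only [tail]
  rw [← integral_sub (integrableOn_volterra_kernel hD hB hw hi i)
    (integrableOn_volterra_kernel hD hB hw' hi' i)]
  simp [Matrix.mulVec_sub, mul_sub]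

/-- Solutions of `w' = i D w + B w` with a prescribed limit in the kernel of `D`. -/
theorem exists_hasDerivAt_tendsto (hD : ∀ i, e.sgn * (D i).im ≤ 0) (hB : Continuous B)
    {a : ℝ} (hBi : IntegrableOn (fun y => ‖B y‖) (e.ray a)) {c : ι → ℂ} (hc : D * c = 0) :
    ∃ w : ℝ → ι → ℂ, (∀ x, HasDerivAt w (Complex.I • (D * w x) + B x *ᵥ w x) x) ∧
      Tendsto w e.filter (𝓝 c) := by
  set b : ℝ → ℝ := fun y => ‖B y‖ with hbdef
  have hb : Continuous b := hB.norm
  have hb0 : ∀ y, 0 ≤ b y := fun y => norm_nonneg _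
  have hbi : IntegrableOn b (e.ray a) := hBi
  -- The unknown is `w = W f` with `f` bounded and continuous on all of `ℝ`. The weight absorbs any
  -- growth towards the opposite end, where `B` need not be integrable, so the fixed point is a
  -- solution on the whole line at once.
  set W : ℝ → ℝ := fun y => Real.exp (2 * tail e b y) with hWdef
  have hWc : Continuous W :=
    continuous_iff_continuousAt.2 fun y => (hasDerivAt_exp_two_tail hb hbi y).continuousAt
  have hW1 : ∀ y, 1 ≤ W y := fun y =>
    Real.one_le_exp (mul_nonneg zero_le_two (tail_nonneg fun s _ => hb0 s))
  have hW0 : ∀ y, 0 < W y := fun y => Real.exp_pos _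
  have hbW := integrableOn_mul_exp_two_tail hb hb0 hbi
  have hlift : ∀ f : BoundedContinuousFunction ℝ (ι → ℂ), Continuous fun y => W y • f y :=
    fun f => hWc.smul f.continuous
  have hle : ∀ (f : BoundedContinuousFunction ℝ (ι → ℂ)) (y : ℝ),
      ‖B y‖ * ‖W y • f y‖ ≤ ‖f‖ * (b y * W y) := fun f y => by
    rw [norm_smul, Real.norm_of_nonneg (hW0 y).le]
    have := f.norm_coe_le_norm y
    have h2 : 0 ≤ b y * W y := mul_nonneg (hb0 y) (hW0 y).le
    calc ‖B y‖ * (W y * ‖f y‖) = ‖f y‖ * (b y * W y) := by rw [hbdef]; ring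
      _ ≤ _ := by gcongr
  have hint : ∀ (f : BoundedContinuousFunction ℝ (ι → ℂ)) (x : ℝ),
      IntegrableOn (fun y => ‖B y‖ * ‖W y • f y‖) (e.ray x) := fun f x =>
    Integrable.mono' ((hbW x).const_mul ‖f‖)
      (hb.mul (hlift f).norm).aestronglyMeasurable (.of_forall fun y => by
        rw [Real.norm_of_nonneg (by positivity)]
        exact hle f y)
  have hbound : ∀ (f : BoundedContinuousFunction ℝ (ι → ℂ)) (x : ℝ),
      ‖(W x)⁻¹ • volterra e D B (fun y => W y • f y) x‖ ≤ ‖f‖ / 2 := fun f x => by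
    rw [norm_smul, norm_inv, Real.norm_of_nonneg (hW0 x).le, inv_mul_le_iff₀ (hW0 x)]
    calc _ ≤ tail e (fun y => ‖B y‖ * ‖W y • f y‖) x := norm_volterra_le hD (hint f x)
      _ ≤ tail e (fun y => ‖f‖ * (b y * W y)) x :=
          tail_mono (hint f x) ((hbW x).const_mul _) fun y _ => hle f y
      _ = ‖f‖ * ((W x - 1) / 2) := by
          rw [← tail_mul_exp_two_tail hb hb0 hbi x]
          exact integral_const_mul _ _
      _ ≤ W x * (‖f‖ / 2) := by nlinarith [norm_nonneg f]
  have hVd := fun f => hasDerivAt_volterra hD hB (hlift f) (hint f a)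
  let T : BoundedContinuousFunction ℝ (ι → ℂ) → BoundedContinuousFunction ℝ (ι → ℂ) := fun f =>
    BoundedContinuousFunction.ofNormedAddCommGroup
      (fun x => (W x)⁻¹ • c - (W x)⁻¹ • volterra e D B (fun y => W y • f y) x)
      (by
        have hV : Continuous (volterra e D B (fun y => W y • f y)) :=
          continuous_iff_continuousAt.2 fun x => (hVd f x).continuousAt
        have hWi : Continuous fun x => (W x)⁻¹ := hWc.inv₀ fun x => (hW0 x).ne'
        exact (hWi.smul continuous_const).sub (hWi.smul hV))
      (‖c‖ + ‖f‖ / 2)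
      (fun x => (norm_sub_le _ _).trans (add_le_add (by
        rw [norm_smul, norm_inv, Real.norm_of_nonneg (hW0 x).le]
        exact mul_le_of_le_one_left (norm_nonneg c) (inv_le_one_of_one_le₀ (hW1 x)))
        (hbound f x)))
  have hT : ContractingWith (1 / 2) T := by
    refine ⟨by norm_num, LipschitzWith.of_dist_le_mul fun f g => ?_⟩
    refine (BoundedContinuousFunction.dist_le (by positivity)).2 fun x => ?_
    have : T f x - T g x = -((W x)⁻¹ • volterra e D B (fun y => W y • (f - g) y) x) := by
      have h := volterra_sub hD hB (hlift f) (hlift g) (hint f x) (hint g x)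
      have h2 : (fun y => W y • (f - g) y) = fun y => W y • f y - W y • g y := by
        funext y
        rw [← smul_sub]
        rfl
      rw [h2, ← h]
      simp only [T, BoundedContinuousFunction.coe_ofNormedAddCommGroup, smul_sub]
      abel
    rw [dist_eq_norm, this, norm_neg, dist_eq_norm]
    refine (hbound (f - g) x).trans (le_of_eq ?_)
    simp
    ring
  obtain ⟨f, hf⟩ : ∃ f, T f = f := ⟨_, hT.fixedPoint_isFixedPt⟩
  have hfix : ∀ x, W x • f x = c - volterra e D B (fun y => W y • f y) x := fun x => by
    conv_lhs => rw [← hf]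
    simp only [T, BoundedContinuousFunction.coe_ofNormedAddCommGroup]
    rw [smul_sub, smul_inv_smul₀ (hW0 x).ne', smul_inv_smul₀ (hW0 x).ne']
  refine ⟨fun y => W y • f y, fun x => ?_, ?_⟩
  · have hd := (hVd f x).const_sub c
    have hval : -(Complex.I • (D * volterra e D B (fun y => W y • f y) x) -
        B x *ᵥ (W x • f x)) = Complex.I • (D * (W x • f x)) + B x *ᵥ (W x • f x) := by
      -- Here `D c = 0` enters: the constant `c` does not contribute to `D w`.
      have h1 : D * (W x • f x) = -(D * volterra e D B (fun y => W y • f y) x) := by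
        rw [hfix x, mul_sub, hc, zero_sub]
      rw [h1, smul_neg]
      abel
    rw [← hval]
    exact hd.congr_of_eventuallyEq (.of_forall hfix)
  · have h0 : Tendsto (volterra e D B fun y => W y • f y) e.filter (𝓝 0) :=
      squeeze_zero_norm (fun x => norm_volterra_le hD (hint f x)) (tendsto_tail_zero e)
    have := (tendsto_const_nhds (x := c)).sub h0
    rw [sub_zero] at this
    exact this.congr fun x => (hfix x).symm

end VolterraExistence

/-! ### Diagonalization by the asymptotic eigenvectors; existence and uniqueness of the columns. -/

section Reduction

attribute [local instance] Matrix.linftyOpNormedRing Matrix.linftyOpNormedAlgebra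
  Matrix.linftyOpNormedAddCommGroup Matrix.linftyOpNormedSpace

/-- The exponents `(λ, k, -λ)`: the eigenvalues of `U_±`, divided by `i`. -/
def exponent (q₀ : ℝ) (z : ℂ) : Fin 3 → ℂ := ![lam q₀ z, kk q₀ z, -lam q₀ z]

/-- `m` is the `j`-th column of the modified Jost eigenfunction `μ_±`, up to the time dependence. -/
def IsModifiedColumn (e : SpatialEnd) (q₀ : ℝ) (f : ℝ → Pot) (p : Pot) (z : ℂ) (j : Fin 3)
    (m : ℝ → Fin 3 → ℂ) : Prop :=
  (∀ x, HasDerivAt m (Umat q₀ (f x) z *ᵥ m x - (Complex.I * exponent q₀ z j) • m x) x) ∧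
    Tendsto m e.filter (𝓝 fun i => Gam q₀ p z i j)

variable {e : SpatialEnd} {q₀ : ℝ} {p : Pot} {z : ℂ} {f : ℝ → Pot}

lemma hasDerivAt_theta (q₀ t : ℝ) (z : ℂ) (j : Fin 3) (x : ℝ) :
    HasDerivAt (fun x => theta q₀ x t z j) (exponent q₀ z j) x := by
  have hx : HasDerivAt (fun x : ℝ => (x : ℂ)) 1 x := Complex.ofRealCLM.hasDerivAt (x := x)
  fin_cases j
  · simpa [theta, exponent] using (hx.add_const _).const_mul (lam q₀ z)
  · simpa [theta, exponent] using (hx.add_const _).const_mul (kk q₀ z)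
  · simpa [theta, exponent] using ((hx.add_const _).const_mul (lam q₀ z)).fun_neg

/-- The `x`-derivative of the phase is the exponent, so the time part of `Θ` only multiplies by a
factor constant in `x` and drops out of the equation. -/
lemma IsJostColumn.isModifiedColumn {q : ℝ → ℝ → Pot} {t : ℝ} {j : Fin 3} {φ : ℝ → Fin 3 → ℂ}
    (h : IsJostColumn e q₀ q p t z j φ) :
    IsModifiedColumn e q₀ (fun x => q x t) p z j (modify q₀ t z j φ) := by
  refine ⟨fun x => ?_, h.2⟩
  have hE := ((hasDerivAt_theta q₀ t z j x).const_mul Complex.I).fun_neg.cexp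
  refine (hE.smul (h.1 x)).congr_deriv ?_
  simp only [modify, Matrix.mulVec_smul, smul_smul, sub_eq_add_neg, ← neg_smul]
  congr 2
  ring

lemma modify_exp_smul (q₀ t : ℝ) (z : ℂ) (j : Fin 3) (m : ℝ → Fin 3 → ℂ) :
    modify q₀ t z j (fun x => Complex.exp (Complex.I * theta q₀ x t z j) • m x) = m := by
  funext x
  rw [modify, smul_smul, ← Complex.exp_add, neg_add_cancel, Complex.exp_zero, one_smul]

lemma exp_smul_modify (q₀ t : ℝ) (z : ℂ) (j : Fin 3) (φ : ℝ → Fin 3 → ℂ) :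
    (fun x => Complex.exp (Complex.I * theta q₀ x t z j) • modify q₀ t z j φ x) = φ := by
  funext x
  rw [modify, smul_smul, ← Complex.exp_add, add_neg_cancel, Complex.exp_zero, one_smul]

lemma IsModifiedColumn.isJostColumn {q : ℝ → ℝ → Pot} {t : ℝ} {j : Fin 3} {m : ℝ → Fin 3 → ℂ}
    (h : IsModifiedColumn e q₀ (fun x => q x t) p z j m) :
    IsJostColumn e q₀ q p t z j
      (fun x => Complex.exp (Complex.I * theta q₀ x t z j) • m x) := by
  refine ⟨fun x => ?_, by rw [modify_exp_smul]; exact h.2⟩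
  have hE := ((hasDerivAt_theta q₀ t z j x).const_mul Complex.I).cexp
  refine (hE.smul (h.1 x)).congr_deriv ?_
  simp only [Matrix.mulVec_smul, smul_smul, smul_sub]
  abel

lemma star_mul_self_add (hp : ‖p‖ = q₀) :
    star (p 0) * p 0 + star (p 1) * p 1 = (q₀ : ℂ) ^ 2 := by
  have h := EuclideanSpace.norm_sq_eq p
  rw [hp, Fin.sum_univ_two] at h
  have h2 : ∀ w : ℂ, star w * w = ((‖w‖ ^ 2 : ℝ) : ℂ) := fun w => by
    rw [Complex.star_def, Complex.conj_mul', Complex.ofReal_pow]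
  rw [h2, h2, ← Complex.ofReal_add, ← h, Complex.ofReal_pow]

lemma GamBd_conjTranspose_mul (hq₀ : 0 < q₀) (hp : ‖p‖ = q₀) :
    (GamBd q₀ p)ᴴ * GamBd q₀ p = 1 := by
  have h := star_mul_self_add hp
  have h0 : (q₀ : ℂ) ≠ 0 := by exact_mod_cast hq₀.ne'
  simp only [Complex.star_def] at h
  ext i j
  fin_cases i <;> fin_cases j <;>
    simp [GamBd, perp, Matrix.mul_apply, Fin.sum_univ_three] <;> field_simp <;>
    first | ring1 | linear_combination h

lemma GamBd_mul_conjTranspose (hq₀ : 0 < q₀) (hp : ‖p‖ = q₀) :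
    GamBd q₀ p * (GamBd q₀ p)ᴴ = 1 :=
  mul_eq_one_comm.1 (GamBd_conjTranspose_mul hq₀ hp)

lemma sigma3_mul_self : sigma3 * sigma3 = 1 := by
  ext i j
  fin_cases i <;> fin_cases j <;> simp [sigma3]

lemma sigma3_mul_Qmat (v : Pot) : sigma3 * Qmat v = -(Qmat v * sigma3) := by
  ext i j
  rw [sigma3, Matrix.neg_apply, Matrix.diagonal_mul, Matrix.mul_diagonal]
  fin_cases i <;> fin_cases j <;> simp [Qmat]

/-- The columns of `Γ_bd` are eigenvectors of `Q_±²`: the eigenvalue is `0` on the direction `q_±^⊥`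
and `-q₀²` on the other two. -/
lemma Qmat_sq_mul_GamBd (hq₀ : 0 < q₀) (hp : ‖p‖ = q₀) :
    Qmat p ^ 2 * GamBd q₀ p = GamBd q₀ p * Matrix.diagonal ![-(q₀ : ℂ) ^ 2, 0, -(q₀ : ℂ) ^ 2] := by
  have h := star_mul_self_add hp
  have h0 : (q₀ : ℂ) ≠ 0 := by exact_mod_cast hq₀.ne'
  simp only [Complex.star_def] at h
  rw [sq]
  ext i j
  fin_cases i <;> fin_cases j <;>
    simp [GamBd, Qmat, perp, Matrix.mul_apply, Fin.sum_univ_three] <;> field_simp <;>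
    first
      | ring1
      | linear_combination -h
      | linear_combination -p 0 * h
      | linear_combination -p 1 * h

lemma Gam_eq (hz : z ≠ 0) (hq₀ : 0 < q₀) (hp : ‖p‖ = q₀) :
    Gam q₀ p z = GamBd q₀ p + (1 / z) • (Complex.I • (sigma3 * Qmat p * GamBd q₀ p)) := by
  have h := star_mul_self_add hp
  have h0 : (q₀ : ℂ) ≠ 0 := by exact_mod_cast hq₀.ne'
  simp only [Complex.star_def] at h
  ext i j
  fin_cases i <;> fin_cases j <;>
    simp [GamBd, Gam, sigma3, Qmat, perp, Matrix.mul_apply, Fin.sum_univ_three] <;> field_simp <;>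
    first
      | linear_combination -h
      | exact Or.inr (by ring1)

/-- The inverse of `Γ_±(z)`. -/
def GamInv (q₀ : ℝ) (p : Pot) (z : ℂ) : Matrix (Fin 3) (Fin 3) ℂ :=
  Matrix.diagonal ![(1 + (q₀ : ℂ) ^ 2 / z ^ 2)⁻¹, 1, (1 + (q₀ : ℂ) ^ 2 / z ^ 2)⁻¹] *
    ((GamBd q₀ p)ᴴ * (1 - (1 / z) • (Complex.I • (sigma3 * Qmat p))))

/-- With `N = (i/z) σ₃ Q_±` one has `Γ_± = (1 + N) Γ_bd` and `N² = Q_±²/z²`, since `σ₃` anticommutes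
with `Q_±`. Thus `(1 - N) Γ_± = (1 - Q_±²/z²) Γ_bd`, which is diagonal in the columns of the unitary
matrix `Γ_bd`. The factor `1 + q₀²/z²` vanishes exactly at `z = ± i q₀`. -/
lemma GamInv_mul_Gam (hq₀ : 0 < q₀) (hp : ‖p‖ = q₀) (hγ : 1 + (q₀ : ℂ) ^ 2 / z ^ 2 ≠ 0) (hz : z ≠ 0) :
    GamInv q₀ p z * Gam q₀ p z = 1 := by
  have h1 : sigma3 * Qmat p * (sigma3 * Qmat p) = -Qmat p ^ 2 := by
    rw [mul_assoc, ← mul_assoc (Qmat p), ← neg_eq_iff_eq_neg.2 (sigma3_mul_Qmat p), neg_mul, mul_neg,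
      mul_assoc, ← mul_assoc sigma3 sigma3, sigma3_mul_self, one_mul, sq]
  have h2 : (1 - (1 / z) • (Complex.I • (sigma3 * Qmat p))) * Gam q₀ p z =
      GamBd q₀ p - (1 / z ^ 2) • (Qmat p ^ 2 * GamBd q₀ p) := by
    rw [Gam_eq hz hq₀ hp]
    simp only [sub_mul, mul_add, one_mul, smul_mul_assoc, mul_smul_comm]
    rw [← mul_assoc (sigma3 * Qmat p) (sigma3 * Qmat p), h1, neg_mul]
    simp only [smul_smul, smul_neg]
    rw [show 1 / z ^ 2 = -(1 / z * Complex.I * (1 / z * Complex.I)) by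
      linear_combination (1 / z ^ 2) * Complex.I_mul_I]
    module
  have h3 : (GamBd q₀ p)ᴴ * (GamBd q₀ p - (1 / z ^ 2) • (Qmat p ^ 2 * GamBd q₀ p)) =
      1 - (1 / z ^ 2) • Matrix.diagonal ![-(q₀ : ℂ) ^ 2, 0, -(q₀ : ℂ) ^ 2] := by
    rw [mul_sub, Matrix.mul_smul, Qmat_sq_mul_GamBd hq₀ hp, ← mul_assoc,
      GamBd_conjTranspose_mul hq₀ hp, one_mul]
  rw [GamInv, mul_assoc, mul_assoc, h2, h3]
  ext i j
  fin_cases i <;> fin_cases j <;> simp [Matrix.mul_apply, Fin.sum_univ_three] <;>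
    rw [mul_comm (z ^ 2)⁻¹, ← div_eq_mul_inv, inv_mul_cancel₀ hγ]

lemma Umat_mul_Gam (hq₀ : 0 < q₀) (hp : ‖p‖ = q₀) (hz : z ≠ 0) :
    Umat q₀ p z * Gam q₀ p z =
      Gam q₀ p z * Matrix.diagonal (fun i => Complex.I * exponent q₀ z i) := by
  have h := star_mul_self_add hp
  have h0 : (q₀ : ℂ) ≠ 0 := by exact_mod_cast hq₀.ne'
  simp only [Complex.star_def] at h
  ext i j
  fin_cases i <;> fin_cases j <;>
    simp [Gam, Umat, exponent, lam, kk, sigma3, Qmat, perp, Matrix.mul_apply, Fin.sum_univ_three] <;>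
    field_simp <;>
    first
      | ring1
      | linear_combination -2 * z ^ 2 * h - 2 * (q₀ : ℂ) ^ 2 * z ^ 2 * Complex.I_sq
      | linear_combination -2 * h
      | linear_combination 2 * z ^ 2 * p 0 * Complex.I_sq
      | linear_combination 2 * z ^ 2 * p 1 * Complex.I_sq

/-- With `r = q₀²/|z|²` the imaginary parts of `λ` and `k` are `Im z (1 - r)/2` and `Im z (1 +
r)/2`. The sign of `1 - r` decides between inside and outside of the circle `|z| = q₀`, which
explains the shape of the regions. -/
lemma exponent_sub_im_nonpos (hq₀ : 0 < q₀) {j : Fin 3} (hz : z ∈ region e q₀ j) (i : Fin 3) :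
    e.sgn * (exponent q₀ z i - exponent q₀ z j).im ≤ 0 := by
  obtain ⟨h0, -, hj⟩ := hz
  have hn : 0 < Complex.normSq z := Complex.normSq_pos.2 h0
  set r := q₀ ^ 2 / Complex.normSq z with hr
  have hr0 : 0 < r := by positivity
  have hdiv : ((q₀ : ℂ) ^ 2 / z).im = -(z.im * r) := by
    rw [Complex.div_im, ← Complex.ofReal_pow, Complex.ofReal_im, Complex.ofReal_re, hr]
    ring
  have hl : (lam q₀ z).im = z.im * (1 - r) / 2 := by
    rw [lam, Complex.div_ofNat_im, Complex.add_im, hdiv]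
    ring
  have hk : (kk q₀ z).im = z.im * (1 + r) / 2 := by
    rw [kk, Complex.div_ofNat_im, Complex.sub_im, hdiv]
    ring
  have hle : ‖z‖ ≤ q₀ → 1 ≤ r := fun h => by
    rw [hr, le_div_iff₀ hn, one_mul, Complex.normSq_eq_norm_sq]
    gcongr
  have hge : q₀ ≤ ‖z‖ → r ≤ 1 := fun h => by
    rw [hr, div_le_iff₀ hn, one_mul, Complex.normSq_eq_norm_sq]
    gcongr
  fin_cases j
  · simp at hj
    rcases hj with hj | ⟨hj, hb⟩
    · fin_cases i <;> simp [exponent, hl, hk, hj]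
    · have := hle hb
      fin_cases i <;> simp [exponent, hl, hk] <;> nlinarith
  · simp at hj
    fin_cases i <;> simp [exponent, hl, hk] <;> nlinarith
  · simp at hj
    rcases hj with hj | ⟨hj, hb⟩
    · fin_cases i <;> simp [exponent, hl, hk, hj]
    · have := hge hb
      fin_cases i <;> simp [exponent, hl, hk] <;> nlinarith

lemma one_add_ne_zero_of_mem_region {j : Fin 3} (hz : z ∈ region e q₀ j) :
    1 + (q₀ : ℂ) ^ 2 / z ^ 2 ≠ 0 := by
  have hz2 : z ^ 2 ≠ 0 := pow_ne_zero 2 hz.1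
  intro h
  apply hz.2.1
  have h2 : (q₀ : ℂ) ^ 2 / z ^ 2 * z ^ 2 = (q₀ : ℂ) ^ 2 := div_mul_cancel₀ _ hz2
  linear_combination z ^ 2 * h - h2

lemma continuous_Qmat : Continuous Qmat := by
  refine continuous_matrix fun i j => ?_
  fin_cases i <;> fin_cases j <;> simp [Qmat] <;> fun_prop

lemma hasDerivAt_mulVec (A : Matrix (Fin 3) (Fin 3) ℂ) {m : ℝ → Fin 3 → ℂ} {m' : Fin 3 → ℂ}
    {x : ℝ} (h : HasDerivAt m m' x) : HasDerivAt (fun y => A *ᵥ m y) (A *ᵥ m') x :=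
  ((Matrix.mulVecLin A).toContinuousLinearMap.restrictScalars ℝ).hasFDerivAt.comp_hasDerivAt x h

lemma diagonal_mulVec_eq (d v : Fin 3 → ℂ) : Matrix.diagonal d *ᵥ v = d * v := by
  funext i
  simp [Matrix.mulVec_diagonal]

/-- Conjugation of the equation for `μ` by `Γ_±` makes its constant part diagonal. -/
lemma GamInv_mulVec_Umat (hq₀ : 0 < q₀) (hp : ‖p‖ = q₀) (hγ : 1 + (q₀ : ℂ) ^ 2 / z ^ 2 ≠ 0)
    (hz : z ≠ 0) (j : Fin 3) (v : Pot) (w : Fin 3 → ℂ) :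
    GamInv q₀ p z *ᵥ (Umat q₀ v z *ᵥ (Gam q₀ p z *ᵥ w) -
        (Complex.I * exponent q₀ z j) • (Gam q₀ p z *ᵥ w)) =
      Complex.I • ((fun i => exponent q₀ z i - exponent q₀ z j) * w) +
        (GamInv q₀ p z * (Qmat v - Qmat p) * Gam q₀ p z) *ᵥ w := by
  have hU : Umat q₀ v z = Umat q₀ p z + (Qmat v - Qmat p) := by
    simp only [Umat]
    abel
  have h1 := GamInv_mul_Gam hq₀ hp hγ hz
  rw [hU, Matrix.add_mulVec, Matrix.mulVec_mulVec, Umat_mul_Gam hq₀ hp hz, Matrix.mulVec_sub,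
    Matrix.mulVec_add, Matrix.mulVec_smul, Matrix.mulVec_mulVec, ← mul_assoc, h1, one_mul,
    Matrix.mulVec_mulVec, Matrix.mulVec_mulVec, Matrix.mulVec_mulVec, h1, Matrix.one_mulVec,
    diagonal_mulVec_eq]
  have : (fun i => Complex.I * exponent q₀ z i) * w - (Complex.I * exponent q₀ z j) • w =
      Complex.I • ((fun i => exponent q₀ z i - exponent q₀ z j) * w) := by
    funext i
    simp
    ring
  rw [← this]
  abel

lemma Gam_mulVec_GamInv (hq₀ : 0 < q₀) (hp : ‖p‖ = q₀) (hγ : 1 + (q₀ : ℂ) ^ 2 / z ^ 2 ≠ 0)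
    (hz : z ≠ 0) (m : Fin 3 → ℂ) : Gam q₀ p z *ᵥ (GamInv q₀ p z *ᵥ m) = m := by
  rw [Matrix.mulVec_mulVec, mul_eq_one_comm.1 (GamInv_mul_Gam hq₀ hp hγ hz), Matrix.one_mulVec]

/-- The size of a solution, vanishing at the end `e`, of the inhomogeneous equation for `μ_j`. -/
theorem norm_le_of_inhomogeneous (hq₀ : 0 < q₀) (hp : ‖p‖ = q₀) {j : Fin 3}
    (hz : z ∈ region e q₀ j) (hf : Continuous f) {a : ℝ}
    (hfi : IntegrableOn (fun y => ‖Qmat (f y) - Qmat p‖) (e.ray a))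
    {r h : ℝ → Fin 3 → ℂ} (hh : Continuous h)
    (hr : ∀ x, HasDerivAt r
      (Umat q₀ (f x) z *ᵥ r x - (Complex.I * exponent q₀ z j) • r x + h x) x)
    (hr0 : Tendsto r e.filter (𝓝 0)) {x : ℝ} {ρ : ℝ → ℝ} (hρi : IntegrableOn ρ (e.ray x))
    (hρ0 : ∀ y, 0 ≤ ρ y) (hle : ∀ y ∈ e.ray x, ‖h y‖ ≤ ρ y)
    {C : ℝ} (hC : ‖Gam q₀ p z‖ ≤ C) (hC' : ‖GamInv q₀ p z‖ ≤ C) :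
    ‖r x‖ ≤ C * (2 * (C * tail e ρ x) *
      Real.exp (2 * tail e (fun y => C * ‖Qmat (f y) - Qmat p‖ * C) x)) := by
  have hγ := one_add_ne_zero_of_mem_region hz
  have hC0 : 0 ≤ C := (norm_nonneg _).trans hC
  have hQc : Continuous fun y => Qmat (f y) - Qmat p := (continuous_Qmat.comp hf).sub continuous_const
  have hback := Gam_mulVec_GamInv hq₀ hp hγ hz.1
  set w : ℝ → Fin 3 → ℂ := fun y => GamInv q₀ p z *ᵥ r y with hw
  set g : ℝ → Fin 3 → ℂ := fun y => (GamInv q₀ p z * (Qmat (f y) - Qmat p) * Gam q₀ p z) *ᵥ w y +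
    GamInv q₀ p z *ᵥ h y with hgdef
  have hrc : Continuous r := continuous_iff_continuousAt.2 fun y => (hr y).continuousAt
  have hwc : Continuous w := continuous_const.matrix_mulVec hrc
  have hgc : Continuous g :=
    (((continuous_const.mul hQc).mul continuous_const).matrix_mulVec hwc).add
      (continuous_const.matrix_mulVec hh)
  have hwd : ∀ y, HasDerivAt w
      (Complex.I • ((fun i => exponent q₀ z i - exponent q₀ z j) * w y) + g y) y := fun y => by
    refine (hasDerivAt_mulVec (GamInv q₀ p z) (hr y)).congr_deriv ?_
    rw [Matrix.mulVec_add, hgdef, ← add_assoc, ← GamInv_mulVec_Umat hq₀ hp hγ hz.1, hw, hback]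
  have hw0 : Tendsto w e.filter (𝓝 0) := by
    have : Continuous fun v : Fin 3 → ℂ => GamInv q₀ p z *ᵥ v :=
      continuous_const.matrix_mulVec continuous_id
    have := (this.tendsto 0).comp hr0
    rwa [Matrix.mulVec_zero] at this
  have hglem : ∀ y ∈ e.ray x, ‖g y‖ ≤ C * ‖Qmat (f y) - Qmat p‖ * C * ‖w y‖ + C * ρ y := by
    intro y hy
    refine (norm_add_le _ _).trans (add_le_add ?_ ?_)
    · refine (Matrix.linfty_opNorm_mulVec _ _).trans (mul_le_mul_of_nonneg_right ?_ (norm_nonneg _))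
      refine (norm_mul_le _ _).trans (mul_le_mul ?_ hC (norm_nonneg _) (by positivity))
      exact (norm_mul_le _ _).trans (mul_le_mul_of_nonneg_right hC' (norm_nonneg _))
    · refine (Matrix.linfty_opNorm_mulVec _ _).trans
        (mul_le_mul hC' (hle y hy) (norm_nonneg _) hC0)
  have key := norm_le_of_hasDerivAt (D := fun i => exponent q₀ z i - exponent q₀ z j)
    (exponent_sub_im_nonpos hq₀ hz) hgc hwd hw0
    (b := fun y => C * ‖Qmat (f y) - Qmat p‖ * C) (by fun_prop) (fun y => by positivity)
    ((hfi.const_mul C).mul_const C) (hρi.const_mul C) (fun y => mul_nonneg hC0 (hρ0 y)) hglem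
  have hCρ : tail e (fun y => C * ρ y) x = C * tail e ρ x := integral_const_mul _ _
  rw [hCρ] at key
  calc ‖r x‖ = ‖Gam q₀ p z *ᵥ w x‖ := by rw [hw, hback]
    _ ≤ ‖Gam q₀ p z‖ * ‖w x‖ := Matrix.linfty_opNorm_mulVec _ _
    _ ≤ _ := mul_le_mul hC key (norm_nonneg _) hC0

theorem existsUnique_isModifiedColumn (hq₀ : 0 < q₀) (hp : ‖p‖ = q₀) {j : Fin 3}
    (hz : z ∈ region e q₀ j) (hf : Continuous f) {a : ℝ}
    (hfi : IntegrableOn (fun y => ‖Qmat (f y) - Qmat p‖) (e.ray a)) :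
    ∃! m, IsModifiedColumn e q₀ f p z j m := by
  have hγ := one_add_ne_zero_of_mem_region hz
  have hQc : Continuous fun y => Qmat (f y) - Qmat p := (continuous_Qmat.comp hf).sub continuous_const
  have hcol : Gam q₀ p z *ᵥ Pi.single j 1 = fun i => Gam q₀ p z i j := by
    rw [Matrix.mulVec_single_one]
    rfl
  -- The `j`-th basis vector is an admissible limit because the `j`-th exponent difference is zero;
  -- `Γ_±` maps it to its `j`-th column.
  obtain ⟨w, hw, hw0⟩ := exists_hasDerivAt_tendsto (exponent_sub_im_nonpos hq₀ hz)
    (B := fun y => GamInv q₀ p z * (Qmat (f y) - Qmat p) * Gam q₀ p z)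
    ((continuous_const.mul hQc).mul continuous_const)
    (a := a) (Integrable.mono' ((hfi.const_mul ‖GamInv q₀ p z‖).mul_const ‖Gam q₀ p z‖)
      ((continuous_const.mul hQc).mul continuous_const).norm.aestronglyMeasurable
      (.of_forall fun y => by
        rw [norm_norm]
        refine (norm_mul_le _ _).trans ?_
        gcongr
        exact norm_mul_le _ _))
    (c := Pi.single j 1) (by
      funext i
      by_cases h : i = j <;> simp [h])
  set m₀ : ℝ → Fin 3 → ℂ := fun y => Gam q₀ p z *ᵥ w y
  have hm₀ : IsModifiedColumn e q₀ f p z j m₀ := by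
    refine ⟨fun x => ?_, ?_⟩
    · refine (hasDerivAt_mulVec (Gam q₀ p z) (hw x)).congr_deriv ?_
      rw [← GamInv_mulVec_Umat hq₀ hp hγ hz.1, Gam_mulVec_GamInv hq₀ hp hγ hz.1]
    · have : Continuous fun v : Fin 3 → ℂ => Gam q₀ p z *ᵥ v :=
        continuous_const.matrix_mulVec continuous_id
      rw [← hcol]
      exact (this.tendsto _).comp hw0
  refine ⟨m₀, hm₀, fun m hm => ?_⟩
  funext x
  have hd : ∀ x, HasDerivAt (fun y => m y - m₀ y) (Umat q₀ (f x) z *ᵥ (m x - m₀ x) -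
      (Complex.I * exponent q₀ z j) • (m x - m₀ x) + 0) x := fun x => by
    refine ((hm.1 x).sub (hm₀.1 x)).congr_deriv ?_
    rw [Matrix.mulVec_sub, smul_sub]
    abel
  have hlim : Tendsto (fun y => m y - m₀ y) e.filter (𝓝 0) := by
    simpa using hm.2.sub hm₀.2
  -- The difference of two solutions vanishes at the end and has zero forcing, so the bound for it
  -- is `0`.
  have := norm_le_of_inhomogeneous hq₀ hp hz hf hfi (h := fun _ => 0) continuous_const hd hlim
    (x := x) (ρ := fun _ => 0) integrableOn_zero (fun _ => le_rfl) (by simp)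
    (le_max_left _ ‖GamInv q₀ p z‖) (le_max_right ‖Gam q₀ p z‖ _)
  have h0 : tail e (fun _ : ℝ => (0 : ℝ)) x = 0 := by simp [tail]
  rw [h0] at this
  simpa [sub_eq_zero] using this

end Reduction

/-! ### Integrability near the end and the coefficient `E₁`. -/

section Expansion

attribute [local instance] Matrix.linftyOpNormedRing Matrix.linftyOpNormedAlgebra
  Matrix.linftyOpNormedAddCommGroup Matrix.linftyOpNormedSpace

variable {e : SpatialEnd} {q₀ : ℝ} {p : Pot} {z : ℂ} {f : ℝ → Pot}

/-- `v ↦ Q(v)` is real linear. -/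
def QmatCLM : Pot →L[ℝ] Matrix (Fin 3) (Fin 3) ℂ :=
  LinearMap.toContinuousLinearMap
    { toFun := Qmat
      map_add' := fun v w => by
        ext i j
        fin_cases i <;> fin_cases j <;> simp [Qmat, add_comm]
      map_smul' := fun c v => by
        ext i j
        fin_cases i <;> fin_cases j <;> simp [Qmat] }

lemma Qmat_sub (v w : Pot) : Qmat (v - w) = Qmat v - Qmat w := QmatCLM.map_sub v w

lemma _root_.HasDerivAt.qmat {f' : Pot} {x : ℝ} (h : HasDerivAt f f' x) :
    HasDerivAt (fun y => Qmat (f y)) (Qmat f') x :=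
  QmatCLM.hasFDerivAt.comp_hasDerivAt x h

lemma norm_apply_le_linfty_opNorm (A : Matrix (Fin 3) (Fin 3) ℂ) (i j : Fin 3) :
    ‖A i j‖ ≤ ‖A‖ := by
  have h : A i j = (A *ᵥ Pi.single j 1) i := by
    rw [Matrix.mulVec_single_one]
    rfl
  rw [h]
  refine (norm_le_pi_norm _ i).trans ((Matrix.linfty_opNorm_mulVec _ _).trans ?_)
  have : ‖(Pi.single j 1 : Fin 3 → ℂ)‖ ≤ 1 := by
    refine (pi_norm_le_iff_of_nonneg zero_le_one).2 fun k => ?_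
    by_cases h : k = j <;> simp [h]
  exact mul_le_of_le_one_right (norm_nonneg _) this

lemma linfty_opNorm_le_of_apply {A : Matrix (Fin 3) (Fin 3) ℂ} {c : ℝ} (hc : 0 ≤ c)
    (h : ∀ i j, ‖A i j‖ ≤ c) : ‖A‖ ≤ 3 * c := by
  lift c to NNReal using hc
  rw [Matrix.linfty_opNorm_def]
  have : (Finset.univ.sup fun i => ∑ j, ‖A i j‖₊) ≤ 3 * c := by
    refine Finset.sup_le fun i _ => ?_
    refine (Finset.sum_le_sum fun j _ => show ‖A i j‖₊ ≤ c from h i j).trans ?_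
    simp
  exact_mod_cast this

lemma norm_Qmat_le (v : Pot) : ‖Qmat v‖ ≤ 3 * ‖v‖ := by
  refine linfty_opNorm_le_of_apply (norm_nonneg v) fun i j => ?_
  have h := PiLp.norm_apply_le v
  fin_cases i <;> fin_cases j <;> simp [Qmat, h]

/-- Continuous matrix functions with an integrable norm near the end `e`. -/
def IntegrableNear (e : SpatialEnd) (x : ℝ) (F : ℝ → Matrix (Fin 3) (Fin 3) ℂ) : Prop :=
  Continuous F ∧ IntegrableOn (fun y => ‖F y‖) (e.ray x)

namespace IntegrableNear

variable {x : ℝ} {F H : ℝ → Matrix (Fin 3) (Fin 3) ℂ}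

lemma of_norm_le {δ : ℝ → ℝ} (hF : Continuous F) (hδ : IntegrableOn δ (e.ray x))
    (h : ∀ y ∈ e.ray x, ‖F y‖ ≤ δ y) : IntegrableNear e x F :=
  ⟨hF, Integrable.mono' hδ hF.norm.aestronglyMeasurable
    ((ae_restrict_iff' (e.measurableSet_ray x)).2 (.of_forall fun y hy => by
      rw [norm_norm]
      exact h y hy))⟩

lemma add (hF : IntegrableNear e x F) (hH : IntegrableNear e x H) :
    IntegrableNear e x (fun y => F y + H y) :=
  of_norm_le (hF.1.add hH.1) (Integrable.add hF.2 hH.2) fun _ _ => norm_add_le _ _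

lemma smul (c : ℂ) (hF : IntegrableNear e x F) : IntegrableNear e x (fun y => c • F y) :=
  of_norm_le (hF.1.const_smul c) (hF.2.const_mul ‖c‖) fun _ _ => norm_smul_le _ _

lemma sub (hF : IntegrableNear e x F) (hH : IntegrableNear e x H) :
    IntegrableNear e x (fun y => F y - H y) :=
  of_norm_le (hF.1.sub hH.1) (Integrable.add hF.2 hH.2) fun _ _ => norm_sub_le _ _

lemma mul_tendsto (hF : IntegrableNear e x F) (hH : Continuous H)
    {L : Matrix (Fin 3) (Fin 3) ℂ} (hL : Tendsto H e.filter (𝓝 L)) :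
    IntegrableNear e x (fun y => F y * H y) := by
  obtain ⟨K, -, hK⟩ := exists_bound_of_tendsto hH hL x
  exact of_norm_le (hF.1.mul hH) (hF.2.mul_const K) fun y hy => (norm_mul_le _ _).trans
    (mul_le_mul_of_nonneg_left (hK y (Set.mem_insert_of_mem _ hy)) (norm_nonneg _))

lemma tendsto_mul (hF : IntegrableNear e x F) (hH : Continuous H)
    {L : Matrix (Fin 3) (Fin 3) ℂ} (hL : Tendsto H e.filter (𝓝 L)) :
    IntegrableNear e x (fun y => H y * F y) := by
  obtain ⟨K, -, hK⟩ := exists_bound_of_tendsto hH hL x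
  exact of_norm_le (hH.mul hF.1) (hF.2.const_mul K) fun y hy => (norm_mul_le _ _).trans
    (mul_le_mul_of_nonneg_right (hK y (Set.mem_insert_of_mem _ hy)) (norm_nonneg _))

lemma mul_const (hF : IntegrableNear e x F) (M : Matrix (Fin 3) (Fin 3) ℂ) :
    IntegrableNear e x (fun y => F y * M) :=
  hF.mul_tendsto continuous_const tendsto_const_nhds

lemma const_mul (M : Matrix (Fin 3) (Fin 3) ℂ) (hF : IntegrableNear e x F) :
    IntegrableNear e x (fun y => M * F y) :=
  hF.tendsto_mul continuous_const tendsto_const_nhds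

end IntegrableNear

/-- The integrand of `S_±`. -/
def bdIntegrand (q₀ : ℝ) (f : ℝ → Pot) (p : Pot) (y : ℝ) : Matrix (Fin 3) (Fin 3) ℂ :=
  (GamBd q₀ p)ᴴ * sigma3 * (Qmat (f y) ^ 2 - Qmat p ^ 2) * GamBd q₀ p

/-- The coefficient `E₁`, in terms of the potential at a fixed time. -/
def E1At (e : SpatialEnd) (q₀ : ℝ) (f : ℝ → Pot) (p : Pot) (x : ℝ) :
    Matrix (Fin 3) (Fin 3) ℂ := E1 e q₀ (fun x _ => f x) p x 0

lemma E1At_apply (x : ℝ) (i j : Fin 3) : E1At e q₀ f p x i j =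
    e.sgn * Complex.I * tail e (fun y => bdIntegrand q₀ f p y i j) x := rfl

lemma continuous_bdIntegrand (hf : Continuous f) : Continuous (bdIntegrand q₀ f p) :=
  (continuous_const.mul (((continuous_Qmat.comp hf).pow 2).sub continuous_const)).mul
    continuous_const

lemma continuous_norm_sub_moment (hf : Continuous f) (p : Pot) :
    Continuous fun x => (1 + |x|) * ‖f x - p‖ := by fun_prop

lemma HasBoundaryValue.integrableNear_Qmat_sub (h : HasBoundaryValue e f p) (hf : Continuous f)
    (x : ℝ) : IntegrableNear e x (fun y => Qmat (f y) - Qmat p) := by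
  refine IntegrableNear.of_norm_le ((continuous_Qmat.comp hf).sub continuous_const)
    (((continuous_norm_sub_moment hf p).integrableOn_ray h.integrable_sub x).const_mul 3)
    fun y _ => ?_
  rw [← Qmat_sub]
  refine (norm_Qmat_le _).trans (mul_le_mul_of_nonneg_left ?_ zero_le_three)
  nlinarith [abs_nonneg y, norm_nonneg (f y - p)]

lemma HasBoundaryValue.tendsto_Qmat (h : HasBoundaryValue e f p) :
    Tendsto (fun y => Qmat (f y)) e.filter (𝓝 (Qmat p)) :=
  (continuous_Qmat.tendsto p).comp h.tendsto

/-- Writing `Q² - Q_±² = Q (Q - Q_±) + (Q - Q_±) Q_±` with `Q` bounded on the ray, the integrand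
inherits the first moment of `q - q_±`. -/
lemma HasBoundaryValue.integrableOn_moment_bdIntegrand (h : HasBoundaryValue e f p) (hf : Continuous f) :
    IntegrableOn (fun y => (1 + |y|) * ‖bdIntegrand q₀ f p y‖) (e.ray 0) := by
  obtain ⟨K, hK0, hK⟩ := exists_bound_of_tendsto (continuous_Qmat.comp hf) h.tendsto_Qmat 0
  set c := ‖(GamBd q₀ p)ᴴ * sigma3‖ * (3 * (K + ‖Qmat p‖)) * ‖GamBd q₀ p‖
  refine Integrable.mono' (h.integrable_sub.const_mul c)
    (Continuous.aestronglyMeasurable (by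
      have := (continuous_bdIntegrand (q₀ := q₀) (p := p) hf).norm
      fun_prop))
    ((ae_restrict_iff' (e.measurableSet_ray 0)).2 (.of_forall fun y hy => ?_))
  rw [Real.norm_of_nonneg (by positivity)]
  have h1 : Qmat (f y) ^ 2 - Qmat p ^ 2 =
      Qmat (f y) * Qmat (f y - p) + Qmat (f y - p) * Qmat p := by
    rw [Qmat_sub]
    noncomm_ring
  have h2 : ‖Qmat (f y) ^ 2 - Qmat p ^ 2‖ ≤ 3 * (K + ‖Qmat p‖) * ‖f y - p‖ := by
    rw [h1]
    have hb := norm_Qmat_le (f y - p)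
    have hQ : ‖Qmat (f y)‖ ≤ K := hK y (Set.mem_insert_of_mem _ hy)
    calc _ ≤ ‖Qmat (f y)‖ * ‖Qmat (f y - p)‖ + ‖Qmat (f y - p)‖ * ‖Qmat p‖ :=
          (norm_add_le _ _).trans (add_le_add (norm_mul_le _ _) (norm_mul_le _ _))
      _ ≤ K * (3 * ‖f y - p‖) + 3 * ‖f y - p‖ * ‖Qmat p‖ := by gcongr
      _ = _ := by ring
  have h3 : ‖bdIntegrand q₀ f p y‖ ≤ c * ‖f y - p‖ := by
    calc _ ≤ ‖(GamBd q₀ p)ᴴ * sigma3‖ * ‖Qmat (f y) ^ 2 - Qmat p ^ 2‖ * ‖GamBd q₀ p‖ :=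
          (norm_mul_le _ _).trans (mul_le_mul_of_nonneg_right (norm_mul_le _ _) (norm_nonneg _))
      _ ≤ ‖(GamBd q₀ p)ᴴ * sigma3‖ * (3 * (K + ‖Qmat p‖) * ‖f y - p‖) * ‖GamBd q₀ p‖ := by
          gcongr
      _ = _ := by
          simp only [c]
          ring
  calc _ ≤ (1 + |y|) * (c * ‖f y - p‖) := by gcongr
    _ = _ := by ring

lemma HasBoundaryValue.integrableNear_bdIntegrand (h : HasBoundaryValue e f p)
    (hf : Continuous f) (x : ℝ) : IntegrableNear e x (bdIntegrand q₀ f p) := by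
  have hc := continuous_bdIntegrand (q₀ := q₀) (p := p) hf
  have hc' := hc.norm
  refine IntegrableNear.of_norm_le hc (Continuous.integrableOn_ray (by fun_prop)
    (h.integrableOn_moment_bdIntegrand (q₀ := q₀) hf) x) fun y _ => ?_
  nlinarith [abs_nonneg y, norm_nonneg (bdIntegrand q₀ f p y)]

lemma HasBoundaryValue.integrable_bdIntegrand_apply (h : HasBoundaryValue e f p)
    (hf : Continuous f) (x : ℝ) (i j : Fin 3) :
    IntegrableOn (fun y => bdIntegrand q₀ f p y i j) (e.ray x) :=
  Integrable.mono' (h.integrableNear_bdIntegrand (q₀ := q₀) hf x).2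
    ((continuous_bdIntegrand hf).matrix_elem i j).aestronglyMeasurable
    (.of_forall fun _ => norm_apply_le_linfty_opNorm _ i j)

/-- The sign in `E₁` cancels the sign from differentiating the tail, so both ends give the same
equation, as the formal expansion requires. -/
lemma HasBoundaryValue.hasDerivAt_E1At (h : HasBoundaryValue e f p) (hf : Continuous f) (x : ℝ) :
    HasDerivAt (E1At e q₀ f p) (-Complex.I • bdIntegrand q₀ f p x) x := by
  refine hasDerivAt_pi.2 fun i => hasDerivAt_pi.2 fun j => ?_
  have := (hasDerivAt_tail ((continuous_bdIntegrand hf).matrix_elem i j)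
    (h.integrable_bdIntegrand_apply (q₀ := q₀) hf 0 i j) x).const_mul ((e.sgn : ℂ) * Complex.I)
  refine this.congr_deriv ?_
  have hs : (e.sgn : ℂ) * e.sgn = 1 := by exact_mod_cast e.sgn_mul_sgn
  simp only [Matrix.smul_apply, smul_eq_mul, Complex.real_smul]
  linear_combination (-Complex.I * bdIntegrand q₀ f p x i j) * hs

lemma tendsto_E1At : Tendsto (E1At e q₀ f p) e.filter (𝓝 0) := by
  refine tendsto_pi_nhds.2 fun i => tendsto_pi_nhds.2 fun j => ?_
  have := (tendsto_tail_zero (h := fun y => bdIntegrand q₀ f p y i j) e).const_mul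
    ((e.sgn : ℂ) * Complex.I)
  rwa [mul_zero] at this

/-- `E₁` is itself a tail, so its integrability is a double integral of the integrand of `S_±`; this
is the place where the first moment is needed. -/
lemma HasBoundaryValue.integrableNear_E1At (h : HasBoundaryValue e f p) (hf : Continuous f)
    (x : ℝ) : IntegrableNear e x (E1At e q₀ f p) := by
  have hcE : Continuous (E1At e q₀ f p) :=
    continuous_iff_continuousAt.2 fun y => (h.hasDerivAt_E1At hf y).continuousAt
  have hN := h.integrableNear_bdIntegrand (q₀ := q₀) hf
  have hT : Continuous (tail e fun y => ‖bdIntegrand q₀ f p y‖) :=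
    continuous_iff_continuousAt.2 fun y => (hasDerivAt_tail (hN 0).1.norm (hN 0).2 y).continuousAt
  refine IntegrableNear.of_norm_le hcE ((hT.integrableOn_ray (integrableOn_tail_of_moment
    (hN 0).1.norm (fun y => norm_nonneg _) (h.integrableOn_moment_bdIntegrand hf)) x).const_mul 3)
    fun y _ => ?_
  refine linfty_opNorm_le_of_apply (tail_nonneg fun _ _ => norm_nonneg _) fun i j => ?_
  rw [E1At_apply, norm_mul, norm_mul, Complex.norm_I, Complex.norm_real, Real.norm_eq_abs,
    e.abs_sgn, one_mul, one_mul]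
  exact norm_tail_le (hN y).2 fun s _ => norm_apply_le_linfty_opNorm _ i j

end Expansion

/-! ### The truncated formal expansion and its defect. -/

section Residual

attribute [local instance] Matrix.linftyOpNormedRing Matrix.linftyOpNormedAlgebra
  Matrix.linftyOpNormedAddCommGroup Matrix.linftyOpNormedSpace

variable {e : SpatialEnd} {q₀ : ℝ} {p : Pot} {z : ℂ} {f : ℝ → Pot}

lemma sigma3_mul_GamBd (q₀ : ℝ) (p : Pot) : sigma3 * GamBd q₀ p = GamBd q₀ p * sigma3 := by
  ext i j
  rw [sigma3, Matrix.diagonal_mul, Matrix.mul_diagonal]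
  fin_cases i <;> fin_cases j <;> simp [GamBd]

/-- `σ₃` anticommutes with the off-diagonal `Q`, hence commutes with `Q²`, and it commutes with the
block-diagonal `Γ_bd`. Commuting with `σ₃` is how block-diagonality enters the algebra. -/
lemma sigma3_mul_bdIntegrand (y : ℝ) :
    sigma3 * bdIntegrand q₀ f p y = bdIntegrand q₀ f p y * sigma3 := by
  have hQ : ∀ v, sigma3 * Qmat v ^ 2 = Qmat v ^ 2 * sigma3 := fun v => by
    rw [sq, ← mul_assoc, sigma3_mul_Qmat, neg_mul, mul_assoc, sigma3_mul_Qmat, mul_neg, neg_neg,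
      mul_assoc]
  have hG : sigma3 * (GamBd q₀ p)ᴴ = (GamBd q₀ p)ᴴ * sigma3 := by
    ext i j
    rw [sigma3, Matrix.diagonal_mul, Matrix.mul_diagonal]
    fin_cases i <;> fin_cases j <;> simp [GamBd]
  rw [bdIntegrand]
  calc _ = (sigma3 * (GamBd q₀ p)ᴴ) * (sigma3 * (Qmat (f y) ^ 2 - Qmat p ^ 2) * GamBd q₀ p) := by
        noncomm_ring
    _ = (GamBd q₀ p)ᴴ * sigma3 * ((Qmat (f y) ^ 2 - Qmat p ^ 2) * (sigma3 * GamBd q₀ p)) := by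
        rw [hG, mul_sub, hQ, hQ]
        noncomm_ring
    _ = _ := by
        rw [sigma3_mul_GamBd]
        noncomm_ring

lemma sigma3_mul_E1At (x : ℝ) : sigma3 * E1At e q₀ f p x = E1At e q₀ f p x * sigma3 := by
  have hd : ∀ y, ∀ i j : Fin 3, sigma3 i i * bdIntegrand q₀ f p y i j =
      bdIntegrand q₀ f p y i j * sigma3 j j := fun y i j => by
    have := congrFun (congrFun (sigma3_mul_bdIntegrand (q₀ := q₀) (f := f) (p := p) y) i) j
    rw [sigma3, Matrix.diagonal_mul, Matrix.mul_diagonal] at this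
    simpa [sigma3] using this
  ext i j
  have h1 : sigma3 i i * tail e (fun y => bdIntegrand q₀ f p y i j) x =
      tail e (fun y => bdIntegrand q₀ f p y i j) x * sigma3 j j := by
    simp only [tail]
    rw [← integral_const_mul, ← integral_mul_const]
    simp only [hd]
  have h2 : sigma3 i i * E1At e q₀ f p x i j = E1At e q₀ f p x i j * sigma3 j j := by
    rw [E1At_apply]
    linear_combination (e.sgn * Complex.I) * h1
  rw [sigma3, Matrix.diagonal_mul, Matrix.mul_diagonal]
  simpa [sigma3] using h2

/-- The matrix `diag(1, -1, -1)`. -/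
def signMat : Matrix (Fin 3) (Fin 3) ℂ := Matrix.diagonal ![1, -1, -1]

lemma kk_eq (hz : z ≠ 0) : kk q₀ z = z / 2 - (q₀ : ℂ) ^ 2 / 2 * (1 / z) := by
  rw [kk]
  field_simp

/-- Sorts the exponents by powers of `z`. The `z` part equals that of `i k σ₃`, so together they
form a commutator with `σ₃` in the equation for `μ`. -/
lemma diagonal_exponent (q₀ : ℝ) (z : ℂ) :
    Matrix.diagonal (fun i => Complex.I * exponent q₀ z i) =
      (Complex.I * z / 2) • sigma3 + (Complex.I * (q₀ : ℂ) ^ 2 / 2 * (1 / z)) • signMat := by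
  rw [sigma3, signMat, ← Matrix.diagonal_smul, ← Matrix.diagonal_smul, Matrix.diagonal_add]
  congr 1
  funext i
  fin_cases i <;> simp [exponent, lam, kk] <;> ring

/-- The coefficient of `1 / z` in the expansion of `μ`. -/
def coeffOne (e : SpatialEnd) (q₀ : ℝ) (f : ℝ → Pot) (p : Pot) (x : ℝ) :
    Matrix (Fin 3) (Fin 3) ℂ :=
  Complex.I • (sigma3 * Qmat (f x) * GamBd q₀ p) + GamBd q₀ p * E1At e q₀ f p x

/-- The block-off-diagonal part of the coefficient of `1 / z²` in the expansion of `μ`. -/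
def coeffTwo (e : SpatialEnd) (q₀ : ℝ) (f : ℝ → Pot) (p : Pot) (x : ℝ) :
    Matrix (Fin 3) (Fin 3) ℂ :=
  Complex.I • (sigma3 * Qmat (f x) * GamBd q₀ p * E1At e q₀ f p x) + Qmat (deriv f x) * GamBd q₀ p

/-- The derivative of `coeffOne`. -/
def coeffOneDeriv (q₀ : ℝ) (f : ℝ → Pot) (p : Pot) (x : ℝ) :
    Matrix (Fin 3) (Fin 3) ℂ :=
  Complex.I • (sigma3 * Qmat (deriv f x) * GamBd q₀ p) +
    GamBd q₀ p * (-Complex.I • bdIntegrand q₀ f p x)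

/-- The derivative of `coeffTwo`. -/
def coeffTwoDeriv (e : SpatialEnd) (q₀ : ℝ) (f : ℝ → Pot) (p : Pot) (x : ℝ) :
    Matrix (Fin 3) (Fin 3) ℂ :=
  Complex.I • (sigma3 * Qmat (deriv f x) * GamBd q₀ p * E1At e q₀ f p x +
      sigma3 * Qmat (f x) * GamBd q₀ p * (-Complex.I • bdIntegrand q₀ f p x)) +
    Qmat (iteratedDeriv 2 f x) * GamBd q₀ p

/-- The truncated expansion of `μ` at `z = ∞`. -/
def truncation (e : SpatialEnd) (q₀ : ℝ) (f : ℝ → Pot) (p : Pot) (z : ℂ) (x : ℝ) :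
    Matrix (Fin 3) (Fin 3) ℂ :=
  GamBd q₀ p + (1 / z) • coeffOne e q₀ f p x + (1 / z) ^ 2 • coeffTwo e q₀ f p x

/-- The coefficient of `1 / z²` in the defect of the truncated expansion. -/
def defectTwo (e : SpatialEnd) (q₀ : ℝ) (f : ℝ → Pot) (p : Pot) (x : ℝ) :
    Matrix (Fin 3) (Fin 3) ℂ :=
  coeffTwoDeriv e q₀ f p x - Qmat (f x) * coeffTwo e q₀ f p x + (Complex.I * (q₀ : ℂ) ^ 2 / 2) •
    (sigma3 * coeffOne e q₀ f p x + coeffOne e q₀ f p x * signMat)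

/-- The coefficient of `1 / z³` in the defect of the truncated expansion. -/
def defectThree (e : SpatialEnd) (q₀ : ℝ) (f : ℝ → Pot) (p : Pot) (x : ℝ) :
    Matrix (Fin 3) (Fin 3) ℂ :=
  (Complex.I * (q₀ : ℂ) ^ 2 / 2) •
    (sigma3 * coeffTwo e q₀ f p x + coeffTwo e q₀ f p x * signMat)

lemma HasBoundaryValue.hasDerivAt_coeffOne (h : HasBoundaryValue e f p) (hf : ContDiff ℝ 2 f)
    (x : ℝ) : HasDerivAt (coeffOne e q₀ f p) (coeffOneDeriv q₀ f p x) x := by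
  have h1 := (hf.differentiable (by norm_num) x).hasDerivAt.qmat
  exact (((h1.const_mul sigma3).mul_const (GamBd q₀ p)).const_smul Complex.I).add
    ((h.hasDerivAt_E1At (q₀ := q₀) hf.continuous x).const_mul (GamBd q₀ p))

lemma hasDerivAt_deriv (hf : ContDiff ℝ 2 f) (x : ℝ) :
    HasDerivAt (deriv f) (iteratedDeriv 2 f x) x := by
  rw [iteratedDeriv_succ, iteratedDeriv_one]
  have : ContDiff ℝ 1 (deriv f) := (contDiff_succ_iff_deriv (n := 1).1 hf).2.2
  exact (this.differentiable (by norm_num) x).hasDerivAt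

lemma HasBoundaryValue.hasDerivAt_coeffTwo (h : HasBoundaryValue e f p) (hf : ContDiff ℝ 2 f)
    (x : ℝ) : HasDerivAt (coeffTwo e q₀ f p) (coeffTwoDeriv e q₀ f p x) x := by
  have h1 := (hf.differentiable (by norm_num) x).hasDerivAt.qmat
  have h2 := (hasDerivAt_deriv hf x).qmat
  exact ((((h1.const_mul sigma3).mul_const (GamBd q₀ p)).mul
    (h.hasDerivAt_E1At (q₀ := q₀) hf.continuous x)).const_smul Complex.I).add
    (h2.mul_const (GamBd q₀ p))

lemma HasBoundaryValue.hasDerivAt_truncation (h : HasBoundaryValue e f p) (hf : ContDiff ℝ 2 f)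
    (z : ℂ) (x : ℝ) : HasDerivAt (truncation e q₀ f p z)
      ((1 / z) • coeffOneDeriv q₀ f p x + (1 / z) ^ 2 • coeffTwoDeriv e q₀ f p x) x := by
  have h1 := ((h.hasDerivAt_coeffOne (q₀ := q₀) hf x).const_smul (1 / z)).const_add (GamBd q₀ p)
  exact h1.add ((h.hasDerivAt_coeffTwo (q₀ := q₀) hf x).const_smul ((1 / z) ^ 2))

/-- The constant `Q_±²` acts on `Γ_bd` by scalars, which are exactly the `1/z` parts of `k σ₃` and
of the exponents. Hence `Γ_bd E₁'` is the block-diagonal part of the equation at order `1/z`. -/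
lemma GamBd_mul_bdIntegrand (hq₀ : 0 < q₀) (hp : ‖p‖ = q₀) (x : ℝ) :
    GamBd q₀ p * bdIntegrand q₀ f p x = sigma3 * Qmat (f x) ^ 2 * GamBd q₀ p +
      ((q₀ : ℂ) ^ 2 / 2) • (sigma3 * GamBd q₀ p + GamBd q₀ p * signMat) := by
  have h2 : sigma3 * (Qmat p ^ 2 * GamBd q₀ p) =
      -(((q₀ : ℂ) ^ 2 / 2) • (sigma3 * GamBd q₀ p + GamBd q₀ p * signMat)) := by
    rw [Qmat_sq_mul_GamBd hq₀ hp, ← mul_assoc, sigma3_mul_GamBd, mul_assoc, ← mul_add,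
      ← mul_smul_comm, ← mul_neg]
    congr 1
    ext i j
    rw [sigma3, signMat, Matrix.diagonal_mul_diagonal, Matrix.diagonal_add, ← Matrix.diagonal_smul]
    fin_cases i <;> fin_cases j <;> simp <;> ring
  rw [bdIntegrand, ← mul_assoc, ← mul_assoc, ← mul_assoc, GamBd_mul_conjTranspose hq₀ hp, one_mul,
    mul_sub, sub_mul, mul_assoc sigma3 (Qmat p ^ 2), h2, sub_neg_eq_add]

/-- The truncated expansion satisfies the equation for `μ` up to terms of order `1 / z²`. -/
lemma truncation_defect (hq₀ : 0 < q₀) (hp : ‖p‖ = q₀) (hz : z ≠ 0) (x : ℝ) :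
    (1 / z) • coeffOneDeriv q₀ f p x + (1 / z) ^ 2 • coeffTwoDeriv e q₀ f p x -
      Umat q₀ (f x) z * truncation e q₀ f p z x +
      truncation e q₀ f p z x * Matrix.diagonal (fun i => Complex.I * exponent q₀ z i) =
    (1 / z) ^ 2 • defectTwo e q₀ f p x + (1 / z) ^ 3 • defectThree e q₀ f p x := by
  have hG := sigma3_mul_GamBd q₀ p
  have hE := sigma3_mul_E1At (e := e) (q₀ := q₀) (f := f) (p := p) x
  have hGN := GamBd_mul_bdIntegrand (f := f) hq₀ hp x
  have hQ := sigma3_mul_Qmat (f x)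
  have hQ' := sigma3_mul_Qmat (deriv f x)
  have hQr : ∀ A, Qmat (f x) * (sigma3 * A) = -(sigma3 * (Qmat (f x) * A)) := fun A => by
    rw [← mul_assoc, ← mul_assoc, hQ, neg_mul, neg_neg]
  have hQr' : ∀ A, Qmat (deriv f x) * (sigma3 * A) = -(sigma3 * (Qmat (deriv f x) * A)) :=
    fun A => by rw [← mul_assoc, ← mul_assoc, hQ', neg_mul, neg_neg]
  have hGr : ∀ A, GamBd q₀ p * (sigma3 * A) = sigma3 * (GamBd q₀ p * A) := fun A => by
    rw [← mul_assoc, ← mul_assoc, hG]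
  have hss : ∀ A, sigma3 * (sigma3 * A) = A := fun A => by
    rw [← mul_assoc, sigma3_mul_self, one_mul]
  -- Moving `σ₃` to the left evaluates the commutators `[σ₃, X₁]` and `[σ₃, X₂]`. The first cancels
  -- `Q X₀` at order `1`, the second the off-diagonal part at order `1/z`.
  have hX1 : coeffOne e q₀ f p x * sigma3 =
      sigma3 * coeffOne e q₀ f p x - (2 * Complex.I) • (Qmat (f x) * GamBd q₀ p) := by
    simp only [coeffOne, mul_add, add_mul, smul_mul_assoc, mul_smul_comm, mul_assoc, ← hE, ← hG,
      hGr, hQr, hss, mul_neg]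
    module
  have hX2 : coeffTwo e q₀ f p x * sigma3 = -(sigma3 * coeffTwo e q₀ f p x) := by
    simp only [coeffTwo, mul_add, add_mul, smul_mul_assoc, mul_smul_comm, mul_assoc, ← hE, ← hG,
      hGr, hQr, hQr', hss, mul_neg]
    module
  have hs2 : sigma3 * coeffTwo e q₀ f p x =
      Complex.I • (Qmat (f x) * GamBd q₀ p * E1At e q₀ f p x) +
        sigma3 * Qmat (deriv f x) * GamBd q₀ p := by
    simp only [coeffTwo, mul_add, mul_smul_comm, mul_assoc, hss]
  have hQ1 : Qmat (f x) * coeffOne e q₀ f p x =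
      -(Complex.I • (sigma3 * Qmat (f x) ^ 2 * GamBd q₀ p)) +
        Qmat (f x) * GamBd q₀ p * E1At e q₀ f p x := by
    simp only [coeffOne, mul_add, mul_smul_comm, mul_assoc, hQr, sq, smul_neg]
  have hD1 : coeffOneDeriv q₀ f p x = Complex.I • (sigma3 * Qmat (deriv f x) * GamBd q₀ p) -
      Complex.I • (sigma3 * Qmat (f x) ^ 2 * GamBd q₀ p) -
      (Complex.I * (q₀ : ℂ) ^ 2 / 2) • (sigma3 * GamBd q₀ p + GamBd q₀ p * signMat) := by
    rw [coeffOneDeriv, mul_smul_comm, hGN]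
    module
  rw [diagonal_exponent, Umat, kk_eq hz, hD1, defectTwo, defectThree, truncation]
  simp only [add_mul, mul_add, smul_mul_assoc, mul_smul_comm, hX1, hX2, hQ1, ← hG, hs2, smul_add,
    smul_sub, smul_neg, smul_smul]
  match_scalars <;> field_simp <;>
    first
      | ring1
      | linear_combination -Complex.I_sq
      | linear_combination (-2 * z ^ 2) * Complex.I_sq

end Residual

/-! ### Integrability of the defect and the expansion at infinity. -/

section Asymptotics

attribute [local instance] Matrix.linftyOpNormedRing Matrix.linftyOpNormedAlgebra
  Matrix.linftyOpNormedAddCommGroup Matrix.linftyOpNormedSpace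

variable {e : SpatialEnd} {q₀ : ℝ} {p : Pot} {z : ℂ} {f : ℝ → Pot}

/-- For the constant potential `Γ_±` is an exact solution, so the defect must vanish; this is its
`1/z²` term. -/
lemma Qmat_mul_GamBd_add (q₀ : ℝ) (p : Pot) :
    Qmat p * GamBd q₀ p + sigma3 * Qmat p * GamBd q₀ p * signMat = 0 := by
  rw [mul_assoc sigma3]
  ext i j
  rw [sigma3, signMat, Matrix.add_apply, Matrix.mul_diagonal, Matrix.diagonal_mul]
  fin_cases i <;> fin_cases j <;>
    simp [Qmat, GamBd, perp, Matrix.mul_apply, Fin.sum_univ_three]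
  ring

lemma integrableNear_Qmat_comp {g : ℝ → Pot} (hg : Continuous g) {a : ℝ}
    (hi : IntegrableOn g (e.ray a)) (x : ℝ) : IntegrableNear e x (fun y => Qmat (g y)) :=
  IntegrableNear.of_norm_le (continuous_Qmat.comp hg)
    (((hg.integrableOn_ray hi x).norm).const_mul 3) fun y _ => norm_Qmat_le (g y)

lemma continuous_iteratedDeriv_two (hf : ContDiff ℝ 2 f) : Continuous (iteratedDeriv 2 f) :=
  hf.continuous_iteratedDeriv 2 le_rfl

lemma continuous_deriv_of_contDiff_two (hf : ContDiff ℝ 2 f) : Continuous (deriv f) :=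
  hf.continuous_deriv (by norm_num)

/-- `q_x` and its derivative are both integrable, which forces `q_x → 0`; the truncation then has
the right limit `Γ_±`. -/
lemma HasBoundaryValue.tendsto_Qmat_deriv (h : HasBoundaryValue e f p) (hf : ContDiff ℝ 2 f) :
    Tendsto (fun y => Qmat (deriv f y)) e.filter (𝓝 0) := by
  have h0 : Tendsto (deriv f) e.filter (𝓝 0) :=
    tendsto_zero_of_integrableOn_ray (hasDerivAt_deriv hf) h.integrable_deriv_two
      h.integrable_deriv
  have hQ0 : Qmat 0 = 0 := QmatCLM.map_zero
  have := (continuous_Qmat.tendsto 0).comp h0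
  rwa [hQ0] at this

lemma continuous_E1At (h : HasBoundaryValue e f p) (hf : Continuous f) :
    Continuous (E1At e q₀ f p) :=
  (h.integrableNear_E1At hf 0).1

lemma HasBoundaryValue.integrableNear_coeffTwo (h : HasBoundaryValue e f p) (hf : ContDiff ℝ 2 f)
    (x : ℝ) : IntegrableNear e x (coeffTwo e q₀ f p) := by
  have hE := h.integrableNear_E1At (q₀ := q₀) hf.continuous x
  have hQ := continuous_Qmat.comp hf.continuous
  have hQG : Tendsto (fun y => sigma3 * Qmat (f y) * GamBd q₀ p) e.filter
      (𝓝 (sigma3 * Qmat p * GamBd q₀ p)) :=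
    (tendsto_const_nhds.mul h.tendsto_Qmat).mul tendsto_const_nhds
  exact ((hE.tendsto_mul ((continuous_const.mul hQ).mul continuous_const) hQG).smul _).add
    ((integrableNear_Qmat_comp (continuous_deriv_of_contDiff_two hf) h.integrable_deriv x).mul_const
      _)

lemma HasBoundaryValue.integrableNear_defectThree (h : HasBoundaryValue e f p)
    (hf : ContDiff ℝ 2 f) (x : ℝ) : IntegrableNear e x (defectThree e q₀ f p) :=
  (((h.integrableNear_coeffTwo hf x).const_mul _).add
    ((h.integrableNear_coeffTwo hf x).mul_const _)).smul _

lemma HasBoundaryValue.integrableNear_defectTwo (h : HasBoundaryValue e f p)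
    (hf : ContDiff ℝ 2 f) (x : ℝ) : IntegrableNear e x (defectTwo e q₀ f p) := by
  have hE := h.integrableNear_E1At (q₀ := q₀) hf.continuous x
  have hN := h.integrableNear_bdIntegrand (q₀ := q₀) hf.continuous x
  have hΔ := h.integrableNear_Qmat_sub hf.continuous x
  have hQc := continuous_Qmat.comp hf.continuous
  have hQ1 := integrableNear_Qmat_comp (continuous_deriv_of_contDiff_two hf) h.integrable_deriv x
  have hQ2 := integrableNear_Qmat_comp (continuous_iteratedDeriv_two hf) h.integrable_deriv_two x
  have hQG : Tendsto (fun y => sigma3 * Qmat (f y) * GamBd q₀ p) e.filter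
      (𝓝 (sigma3 * Qmat p * GamBd q₀ p)) :=
    (tendsto_const_nhds.mul h.tendsto_Qmat).mul tendsto_const_nhds
  have hX2' : IntegrableNear e x (coeffTwoDeriv e q₀ f p) :=
    (((((hQ1.const_mul sigma3).mul_const (GamBd q₀ p)).mul_tendsto
      (continuous_E1At h hf.continuous) tendsto_E1At).add
      ((hN.smul _).tendsto_mul ((continuous_const.mul hQc).mul continuous_const) hQG)).smul _).add
      (hQ2.mul_const _)
  have hX1 : IntegrableNear e x
      (fun y => sigma3 * coeffOne e q₀ f p y + coeffOne e q₀ f p y * signMat) := by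
    -- `coeffOne` has a nonzero limit, so it is not integrable by itself. Subtracting the identity
    -- for the constant potential leaves only the integrable `Q - Q_±` and `E₁`.
    have heq : (fun y => sigma3 * coeffOne e q₀ f p y + coeffOne e q₀ f p y * signMat) =
        fun y => Complex.I • ((Qmat (f y) - Qmat p) * GamBd q₀ p +
            sigma3 * (Qmat (f y) - Qmat p) * (GamBd q₀ p * signMat)) +
          (sigma3 * GamBd q₀ p * E1At e q₀ f p y + GamBd q₀ p * E1At e q₀ f p y * signMat) := by
      funext y
      have h0 := Qmat_mul_GamBd_add q₀ p
      have hss : ∀ A, sigma3 * (sigma3 * A) = A := fun A => by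
        rw [← mul_assoc, sigma3_mul_self, one_mul]
      have h1 : Complex.I • (Qmat p * GamBd q₀ p + sigma3 * Qmat p * GamBd q₀ p * signMat) = 0 := by
        rw [h0, smul_zero]
      rw [← add_zero (sigma3 * coeffOne e q₀ f p y + _), ← neg_zero, ← h1]
      simp only [coeffOne, mul_add, add_mul, sub_mul, mul_sub, mul_smul_comm, smul_mul_assoc,
        mul_assoc, hss]
      module
    rw [heq]
    exact (((hΔ.mul_const _).add ((hΔ.const_mul _).mul_const _)).smul _).add
      ((hE.const_mul _).add ((hE.const_mul _).mul_const _))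
  exact (hX2'.sub ((h.integrableNear_coeffTwo hf x).tendsto_mul hQc h.tendsto_Qmat)).add
    (hX1.smul _)

lemma HasBoundaryValue.tendsto_truncation (h : HasBoundaryValue e f p) (hf : ContDiff ℝ 2 f)
    (hq₀ : 0 < q₀) (hp : ‖p‖ = q₀) (hz : z ≠ 0) :
    Tendsto (truncation e q₀ f p z) e.filter (𝓝 (Gam q₀ p z)) := by
  have hQG : Tendsto (fun y => sigma3 * Qmat (f y) * GamBd q₀ p) e.filter
      (𝓝 (sigma3 * Qmat p * GamBd q₀ p)) :=
    (tendsto_const_nhds.mul h.tendsto_Qmat).mul tendsto_const_nhds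
  have hE : Tendsto (E1At e q₀ f p) e.filter (𝓝 0) := tendsto_E1At
  have h1 := (hQG.const_smul Complex.I).add (hE.const_mul (GamBd q₀ p))
  have h2 := ((hQG.mul hE).const_smul Complex.I).add
    ((h.tendsto_Qmat_deriv hf).mul_const (GamBd q₀ p))
  have := ((h1.const_smul (1 / z)).const_add (GamBd q₀ p)).add (h2.const_smul ((1 / z) ^ 2))
  rw [mul_zero, mul_zero, smul_zero, zero_mul, add_zero, add_zero, smul_zero, add_zero] at this
  rw [Gam_eq hz hq₀ hp]
  exact this

lemma leadInf_eq (hq₀ : 0 < q₀) (hz : z ≠ 0) (v : Pot) :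
    leadInf q₀ v p z = GamBd q₀ p + (1 / z) • (Complex.I • (sigma3 * Qmat v * GamBd q₀ p)) := by
  have h0 : (q₀ : ℂ) ≠ 0 := by exact_mod_cast hq₀.ne'
  ext i j
  fin_cases i <;> fin_cases j <;>
    simp [GamBd, leadInf, herm, sigma3, Qmat, perp, Matrix.mul_apply, Fin.sum_univ_three] <;>
    field_simp <;> ring_nf

lemma truncation_eq (hq₀ : 0 < q₀) (hz : z ≠ 0) (x : ℝ) :
    truncation e q₀ f p z x = leadInf q₀ (f x) p z +
      (1 / z) • (GamBd q₀ p * E1At e q₀ f p x) + (1 / z) ^ 2 • coeffTwo e q₀ f p x := by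
  rw [leadInf_eq hq₀ hz, truncation, coeffOne, smul_add]
  abel

/-- Both `Γ_±(z)` and its inverse converge as `z → ∞`, so the constants in the Grönwall bound can be
taken independent of `z`. -/
lemma exists_bound_Gam (hq₀ : 0 < q₀) (hp : ‖p‖ = q₀) :
    ∃ C, ∀ᶠ z in Bornology.cobounded ℂ, ‖Gam q₀ p z‖ ≤ C ∧ ‖GamInv q₀ p z‖ ≤ C := by
  have hinv : Tendsto (fun z : ℂ => 1 / z) (Bornology.cobounded ℂ) (𝓝 0) := by
    simpa only [one_div] using tendsto_inv₀_cobounded (α := ℂ)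
  have hne : ∀ᶠ z in Bornology.cobounded ℂ, z ≠ 0 := by
    filter_upwards [tendsto_norm_cobounded_atTop.eventually_gt_atTop 0] with z hz
    exact norm_pos_iff.1 hz
  have h1 : Tendsto (Gam q₀ p) (Bornology.cobounded ℂ) (𝓝 (GamBd q₀ p)) := by
    have := ((hinv.smul_const (Complex.I • (sigma3 * Qmat p * GamBd q₀ p))).const_add (GamBd q₀ p))
    rw [zero_smul, add_zero] at this
    refine this.congr' ?_
    filter_upwards [hne] with z hz
    rw [Gam_eq hz hq₀ hp]
  have hγ : Tendsto (fun z : ℂ => (1 + (q₀ : ℂ) ^ 2 / z ^ 2)⁻¹) (Bornology.cobounded ℂ) (𝓝 1) := by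
    have := (((hinv.pow 2).const_mul ((q₀ : ℂ) ^ 2)).const_add 1).inv₀ (by simp)
    simpa [div_eq_mul_inv] using this
  have hd : Tendsto (fun z : ℂ => (Matrix.diagonal ![(1 + (q₀ : ℂ) ^ 2 / z ^ 2)⁻¹, 1,
      (1 + (q₀ : ℂ) ^ 2 / z ^ 2)⁻¹] : Matrix (Fin 3) (Fin 3) ℂ)) (Bornology.cobounded ℂ)
      (𝓝 (Matrix.diagonal ![1, 1, 1])) := by
    have hc : Continuous fun w : ℂ => (Matrix.diagonal ![w, 1, w] : Matrix (Fin 3) (Fin 3) ℂ) := by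
      refine continuous_matrix fun i j => ?_
      fin_cases i <;> fin_cases j <;> simp <;> fun_prop
    exact (hc.tendsto 1).comp hγ
  have h2 : Tendsto (GamInv q₀ p) (Bornology.cobounded ℂ) _ :=
    hd.mul (((hinv.smul_const (Complex.I • (sigma3 * Qmat p))).const_sub 1).const_mul
      (GamBd q₀ p)ᴴ)
  obtain ⟨C₁, hC₁⟩ := h1.norm.isBoundedUnder_le
  obtain ⟨C₂, hC₂⟩ := h2.norm.isBoundedUnder_le
  refine ⟨max C₁ C₂, ?_⟩
  filter_upwards [eventually_map.1 hC₁, eventually_map.1 hC₂] with z h1 h2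
  exact ⟨h1.trans (le_max_left _ _), h2.trans (le_max_right _ _)⟩

/-- The expansion of the columns of `μ` at `z = ∞`. -/
theorem HasBoundaryValue.exists_expansion_bound (h : HasBoundaryValue e f p) (hf : ContDiff ℝ 2 f)
    (hq₀ : 0 < q₀) (hp : ‖p‖ = q₀) (j : Fin 3) (x : ℝ) :
    ∃ C, ∀ᶠ z in Bornology.cobounded ℂ, z ∈ region e q₀ j →
      ∀ m, IsModifiedColumn e q₀ f p z j m → ∀ i,
        ‖m x i - (leadInf q₀ (f x) p z + (1 / z) • (GamBd q₀ p * E1At e q₀ f p x)) i j‖ ≤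
          C * ‖1 / z ^ 2‖ := by
  obtain ⟨C, hC⟩ := exists_bound_Gam hq₀ hp
  have hR2 := h.integrableNear_defectTwo (q₀ := q₀) hf
  have hR3 := h.integrableNear_defectThree (q₀ := q₀) hf
  have hΔ := h.integrableNear_Qmat_sub hf.continuous
  set ρ : ℝ → ℝ := fun y => ‖defectTwo e q₀ f p y‖ + ‖defectThree e q₀ f p y‖ with hρ
  have hρi : IntegrableOn ρ (e.ray x) := (hR2 x).2.add (hR3 x).2
  refine ⟨C * (2 * (C * tail e ρ x) *
    Real.exp (2 * tail e (fun y => C * ‖Qmat (f y) - Qmat p‖ * C) x)) + ‖coeffTwo e q₀ f p x‖, ?_⟩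
  have hbig : ∀ᶠ z in Bornology.cobounded ℂ, 1 ≤ ‖z‖ :=
    tendsto_norm_cobounded_atTop.eventually_ge_atTop 1
  filter_upwards [hC, hbig] with z hCz hz1 hz m hm i
  have hz0 : z ≠ 0 := hz.1
  set A : ℝ → Fin 3 → ℂ := fun y => truncation e q₀ f p z y *ᵥ Pi.single j 1 with hA
  set R : ℝ → Matrix (Fin 3) (Fin 3) ℂ := fun y =>
    (1 / z) ^ 2 • defectTwo e q₀ f p y + (1 / z) ^ 3 • defectThree e q₀ f p y with hRdef
  have hAi : ∀ y i, A y i = truncation e q₀ f p z y i j := fun y i => by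
    change (truncation e q₀ f p z y *ᵥ Pi.single j 1) i = _
    rw [Matrix.mulVec_single_one]
    rfl
  have hRc : Continuous R := ((hR2 x).1.const_smul ((1 / z) ^ 2)).add
    ((hR3 x).1.const_smul ((1 / z) ^ 3))
  have hAd : ∀ y, HasDerivAt A (Umat q₀ (f y) z *ᵥ A y - (Complex.I * exponent q₀ z j) • A y +
      R y *ᵥ Pi.single j 1) y := fun y => by
    have hd := h.hasDerivAt_truncation (q₀ := q₀) hf z y
    have hd' : HasDerivAt A (((1 / z) • coeffOneDeriv q₀ f p y +
        (1 / z) ^ 2 • coeffTwoDeriv e q₀ f p y) *ᵥ Pi.single j 1) y := by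
      refine hasDerivAt_pi.2 fun k => ?_
      simp only [hAi, Matrix.mulVec_single_one, Matrix.col_apply]
      exact hasDerivAt_pi.1 (hasDerivAt_pi.1 hd k) j
    refine hd'.congr_deriv ?_
    simp only [hRdef]
    rw [← truncation_defect hq₀ hp hz0, Matrix.add_mulVec (_ - _), Matrix.sub_mulVec,
      ← Matrix.mulVec_mulVec, ← Matrix.mulVec_mulVec]
    have : Matrix.diagonal (fun i => Complex.I * exponent q₀ z i) *ᵥ Pi.single j 1 =
        (Complex.I * exponent q₀ z j) • (Pi.single j 1 : Fin 3 → ℂ) := by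
      rw [diagonal_mulVec_eq]
      funext k
      by_cases hk : k = j
      · subst hk
        simp
      · simp [hk]
    rw [this, Matrix.mulVec_smul]
    simp only [hA]
    abel
  have hrd : ∀ y, HasDerivAt (fun y => m y - A y) (Umat q₀ (f y) z *ᵥ (m y - A y) -
      (Complex.I * exponent q₀ z j) • (m y - A y) + -(R y *ᵥ Pi.single j 1)) y := fun y => by
    refine ((hm.1 y).sub (hAd y)).congr_deriv ?_
    rw [Matrix.mulVec_sub, smul_sub]
    abel
  have hr0 : Tendsto (fun y => m y - A y) e.filter (𝓝 0) := by
    have hAl : Tendsto A e.filter (𝓝 fun i => Gam q₀ p z i j) := by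
      refine tendsto_pi_nhds.2 fun k => ?_
      simp only [hAi]
      exact tendsto_pi_nhds.1 (tendsto_pi_nhds.1 (h.tendsto_truncation hf hq₀ hp hz0) k) j
    simpa using hm.2.sub hAl
  have hle : ∀ y ∈ e.ray x, ‖-(R y *ᵥ (Pi.single j 1 : Fin 3 → ℂ))‖ ≤ ‖1 / z ^ 2‖ * ρ y := by
    intro y _
    rw [norm_neg]
    have hR : ‖R y‖ ≤ ‖1 / z ^ 2‖ * ρ y := by
      refine (norm_add_le _ _).trans ?_
      -- For `|z| ≥ 1` the cubic part of the defect is absorbed into the quadratic one.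
      have h3 : ‖(1 / z) ^ 3‖ ≤ ‖1 / z ^ 2‖ := by
        rw [norm_pow, norm_div, norm_one, norm_div, norm_one, norm_pow, ← _root_.one_div_pow]
        exact pow_le_pow_of_le_one (by positivity) (by
          rw [div_le_one (by linarith)]
          exact hz1) (by norm_num)
      calc _ ≤ ‖(1 / z) ^ 2‖ * ‖defectTwo e q₀ f p y‖ + ‖(1 / z) ^ 3‖ * ‖defectThree e q₀ f p y‖ :=
            add_le_add (norm_smul_le _ _) (norm_smul_le _ _)
        _ ≤ ‖1 / z ^ 2‖ * ‖defectTwo e q₀ f p y‖ + ‖1 / z ^ 2‖ * ‖defectThree e q₀ f p y‖ := by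
            rw [_root_.one_div_pow z 2]
            gcongr
        _ = _ := by
            simp only [hρ]
            ring
    refine (pi_norm_le_iff_of_nonneg ((norm_nonneg _).trans hR)).2 fun k => ?_
    rw [Matrix.mulVec_single_one]
    exact (norm_apply_le_linfty_opNorm _ k j).trans hR
  have key := norm_le_of_inhomogeneous hq₀ hp hz hf.continuous (hΔ x).2
    (hRc.matrix_mulVec continuous_const).neg hrd hr0 (hρi.const_mul ‖1 / z ^ 2‖)
    (fun y => by positivity) hle hCz.1 hCz.2
  have htail : tail e (fun y => ‖1 / z ^ 2‖ * ρ y) x = ‖1 / z ^ 2‖ * tail e ρ x :=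
    integral_const_mul _ _
  rw [htail] at key
  -- `coeffTwo` was needed to make the defect small, but its own contribution has the size of the
  -- allowed error.
  have hsplit : m x i - (leadInf q₀ (f x) p z + (1 / z) • (GamBd q₀ p * E1At e q₀ f p x)) i j =
      (m x - A x) i + (1 / z ^ 2) * coeffTwo e q₀ f p x i j := by
    rw [Pi.sub_apply, hAi, truncation_eq hq₀ hz0]
    simp only [Matrix.add_apply, Matrix.smul_apply, smul_eq_mul, _root_.one_div_pow]
    ring
  rw [hsplit]
  refine (norm_add_le _ _).trans ?_
  rw [norm_mul, add_mul]
  refine add_le_add (((norm_le_pi_norm (m x - A x) i).trans key).trans (le_of_eq (by ring))) ?_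
  rw [mul_comm]
  exact mul_le_mul_of_nonneg_right (norm_apply_le_linfty_opNorm _ i j) (norm_nonneg _)

end Asymptotics

/-! ### The symmetry `z ↦ -q₀²/z` and the passage from infinity to zero. -/

section Symmetry

variable {e : SpatialEnd} {q₀ : ℝ} {p : Pot} {z : ℂ} {f : ℝ → Pot}

/-- The involution `z ↦ -q₀² / z` of the uniformization variable, which exchanges `0` and `∞`. -/
def conjugatePoint (q₀ : ℝ) (z : ℂ) : ℂ := -(q₀ : ℂ) ^ 2 / z

/-- The scalars relating the columns of `Γ_±` at `z` and at `-q₀² / z`. -/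
def symmFactor (q₀ : ℝ) (z : ℂ) : Fin 3 → ℂ := ![Complex.I * q₀ / z, 1, Complex.I * q₀ / z]

lemma conjugatePoint_ne_zero (hq₀ : 0 < q₀) (hz : z ≠ 0) : conjugatePoint q₀ z ≠ 0 := by
  have h0 : (q₀ : ℂ) ≠ 0 := by exact_mod_cast hq₀.ne'
  exact div_ne_zero (neg_ne_zero.2 (pow_ne_zero 2 h0)) hz

lemma symmFactor_ne_zero (hq₀ : 0 < q₀) (hz : z ≠ 0) (j : Fin 3) : symmFactor q₀ z j ≠ 0 := by
  have h0 : (q₀ : ℂ) ≠ 0 := by exact_mod_cast hq₀.ne'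
  fin_cases j <;> simp [symmFactor, h0, hz]

lemma kk_conjugatePoint (hq₀ : 0 < q₀) (hz : z ≠ 0) : kk q₀ (conjugatePoint q₀ z) = kk q₀ z := by
  have h0 : (q₀ : ℂ) ≠ 0 := by exact_mod_cast hq₀.ne'
  simp only [kk, conjugatePoint]
  field_simp
  ring

lemma lam_conjugatePoint (hq₀ : 0 < q₀) (hz : z ≠ 0) :
    lam q₀ (conjugatePoint q₀ z) = -lam q₀ z := by
  have h0 : (q₀ : ℂ) ≠ 0 := by exact_mod_cast hq₀.ne'
  simp only [lam, conjugatePoint]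
  field_simp
  ring

lemma exponent_conjugatePoint (hq₀ : 0 < q₀) (hz : z ≠ 0) (j : Fin 3) :
    exponent q₀ (conjugatePoint q₀ z) j.rev = exponent q₀ z j := by
  fin_cases j <;>
    simp [exponent, kk_conjugatePoint hq₀ hz, lam_conjugatePoint hq₀ hz]

lemma Gam_conjugatePoint (hq₀ : 0 < q₀) (hz : z ≠ 0) (i j : Fin 3) :
    Gam q₀ p (conjugatePoint q₀ z) i j.rev = (symmFactor q₀ z j)⁻¹ * Gam q₀ p z i j := by
  have h0 : (q₀ : ℂ) ≠ 0 := by exact_mod_cast hq₀.ne'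
  fin_cases i <;> fin_cases j <;>
    simp [Gam, symmFactor, conjugatePoint] <;> field_simp <;> simp

/-- The map preserves the sign of `Im z`, exchanges the inside and the outside of `|z| = q₀` and
permutes `± i q₀`; it thus swaps the first and third regions and keeps the second. -/
lemma conjugatePoint_mem_region (hq₀ : 0 < q₀) {j : Fin 3} (hz : z ∈ region e q₀ j) :
    conjugatePoint q₀ z ∈ region e q₀ j.rev := by
  obtain ⟨hz0, hz2, hj⟩ := hz
  have h0 : (q₀ : ℂ) ≠ 0 := by exact_mod_cast hq₀.ne'
  have hn : 0 < Complex.normSq z := Complex.normSq_pos.2 hz0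
  have him : (conjugatePoint q₀ z).im = q₀ ^ 2 / Complex.normSq z * z.im := by
    rw [conjugatePoint, neg_div, Complex.neg_im, Complex.div_im, ← Complex.ofReal_pow,
      Complex.ofReal_im, Complex.ofReal_re]
    ring
  have hr : 0 < q₀ ^ 2 / Complex.normSq z := by positivity
  have hnorm : ‖conjugatePoint q₀ z‖ = q₀ ^ 2 / ‖z‖ := by
    rw [conjugatePoint, norm_div, norm_neg, norm_pow, Complex.norm_real, Real.norm_eq_abs, sq_abs]
  have hzn : 0 < ‖z‖ := norm_pos_iff.2 hz0
  have hsgn : e.sgn * (conjugatePoint q₀ z).im = q₀ ^ 2 / Complex.normSq z * (e.sgn * z.im) := by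
    rw [him]
    ring
  have hzero : z.im = 0 → (conjugatePoint q₀ z).im = 0 := fun h => by rw [him, h, mul_zero]
  have hnonpos : e.sgn * z.im ≤ 0 → e.sgn * (conjugatePoint q₀ z).im ≤ 0 := fun h => by
    rw [hsgn]
    exact mul_nonpos_of_nonneg_of_nonpos hr.le h
  refine ⟨conjugatePoint_ne_zero hq₀ hz0, fun h => hz2 ?_, ?_⟩
  · rw [conjugatePoint, div_pow, div_eq_iff (pow_ne_zero 2 hz0)] at h
    have : (q₀ : ℂ) ^ 2 * (z ^ 2 + (q₀ : ℂ) ^ 2) = 0 := by linear_combination h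
    rcases mul_eq_zero.1 this with h' | h'
    · exact absurd h' (pow_ne_zero 2 h0)
    · linear_combination h'
  · fin_cases j
    · change z.im = 0 ∨ (e.sgn * z.im ≤ 0 ∧ ‖z‖ ≤ q₀) at hj
      change _ ∨ (_ ∧ q₀ ≤ _)
      refine hj.imp hzero fun h => ⟨hnonpos h.1, ?_⟩
      rw [hnorm, le_div_iff₀ hzn]
      nlinarith [h.2]
    · change 0 ≤ e.sgn * z.im at hj
      change 0 ≤ e.sgn * _
      rw [hsgn]
      positivity
    · change z.im = 0 ∨ (e.sgn * z.im ≤ 0 ∧ q₀ ≤ ‖z‖) at hj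
      change _ ∨ (_ ∧ _ ≤ q₀)
      refine hj.imp hzero fun h => ⟨hnonpos h.1, ?_⟩
      rw [hnorm, div_le_iff₀ hzn]
      nlinarith [h.2]

lemma IsModifiedColumn.conjugatePoint (hq₀ : 0 < q₀) (hz : z ≠ 0) {j : Fin 3}
    {m : ℝ → Fin 3 → ℂ} (hm : IsModifiedColumn e q₀ f p z j m) :
    IsModifiedColumn e q₀ f p (conjugatePoint q₀ z) j.rev
      (fun x => (symmFactor q₀ z j)⁻¹ • m x) := by
  refine ⟨fun x => ?_, ?_⟩
  · refine ((hm.1 x).const_smul (symmFactor q₀ z j)⁻¹).congr_deriv ?_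
    have hU : Umat q₀ (f x) (CMKdV.conjugatePoint q₀ z) = Umat q₀ (f x) z := by
      rw [Umat, Umat, kk_conjugatePoint hq₀ hz]
    rw [exponent_conjugatePoint hq₀ hz, hU, smul_sub, Matrix.mulVec_smul,
      smul_comm (symmFactor q₀ z j)⁻¹ (Complex.I * exponent q₀ z j)]
  · have := hm.2.const_smul (symmFactor q₀ z j)⁻¹
    have hlim : (fun i => Gam q₀ p (CMKdV.conjugatePoint q₀ z) i j.rev) =
        (symmFactor q₀ z j)⁻¹ • fun i => Gam q₀ p z i j := by
      funext i
      rw [Gam_conjugatePoint hq₀ hz]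
      rfl
    rw [hlim]
    exact this

lemma tendsto_conjugatePoint (hq₀ : 0 < q₀) (j : Fin 3) :
    Tendsto (conjugatePoint q₀) (𝓝[region e q₀ j] 0) (Bornology.cobounded ℂ) := by
  have h0 : (q₀ : ℂ) ≠ 0 := by exact_mod_cast hq₀.ne'
  have h1 : Tendsto (fun z : ℂ => z⁻¹) (𝓝[region e q₀ j] 0) (Bornology.cobounded ℂ) :=
    tendsto_inv₀_nhdsNE_zero.mono_left (nhdsWithin_mono _ fun z hz => hz.1)
  rw [← tendsto_norm_atTop_iff_cobounded] at h1 ⊢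
  refine (h1.const_mul_atTop (show 0 < q₀ ^ 2 by positivity)).congr fun z => ?_
  rw [conjugatePoint, norm_div, norm_neg, norm_pow, Complex.norm_real, Real.norm_eq_abs, sq_abs,
    norm_inv, div_eq_mul_inv]

/-- Turns the error `1/ẑ²` at `ẑ = -q₀²/z` into `O(z)`. The constant `q₀ + 1` covers both the factor
`i q₀/z` and the factor `1`, the latter by `|z| ≤ 1`. -/
lemma norm_symmFactor_mul_le (hq₀ : 0 < q₀) (hz : z ≠ 0) (hz1 : ‖z‖ ≤ 1) (j : Fin 3) :
    ‖symmFactor q₀ z j‖ * ‖1 / conjugatePoint q₀ z ^ 2‖ ≤ ((q₀ + 1) / q₀ ^ 4) * ‖z‖ := by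
  have hzn : 0 < ‖z‖ := norm_pos_iff.2 hz
  have h1 : ‖1 / conjugatePoint q₀ z ^ 2‖ = ‖z‖ ^ 2 / q₀ ^ 4 := by
    rw [conjugatePoint, norm_div, norm_one, norm_pow, norm_div, norm_neg, norm_pow,
      Complex.norm_real, Real.norm_eq_abs, sq_abs]
    field_simp
  have h2 : ‖symmFactor q₀ z j‖ * ‖z‖ ≤ q₀ + 1 := by
    have h3 : ‖Complex.I * q₀ / z‖ * ‖z‖ = q₀ := by
      rw [norm_div, norm_mul, Complex.norm_I, one_mul, Complex.norm_real, Real.norm_eq_abs,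
        abs_of_pos hq₀, div_mul_cancel₀ _ hzn.ne']
    fin_cases j
    · exact (h3.le).trans (by linarith)
    · change ‖(1 : ℂ)‖ * ‖z‖ ≤ _
      rw [norm_one]
      linarith
    · exact (h3.le).trans (by linarith)
  rw [h1]
  calc _ = (‖symmFactor q₀ z j‖ * ‖z‖) * (‖z‖ / q₀ ^ 4) := by ring
    _ ≤ (q₀ + 1) * (‖z‖ / q₀ ^ 4) := by gcongr
    _ = _ := by ring

/-- Since `1/ẑ = -z/q₀²`, multiplication by `i q₀/z` turns `(1/ẑ)(± i S)` into the constant `±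
S/q₀`; this is the origin of `F₀`, and its last matrix factor records the exchange of the outer
columns. For those columns the two explicit parts agree exactly. -/
lemma exists_leadZero_bound (hq₀ : 0 < q₀) (s : ℝ) (v p : Pot) (S : Matrix (Fin 3) (Fin 3) ℂ)
    (i j : Fin 3) :
    ∃ K, ∀ z : ℂ, z ≠ 0 →
      ‖symmFactor q₀ z j * (leadInf q₀ v p (conjugatePoint q₀ z) +
          (1 / conjugatePoint q₀ z) • (GamBd q₀ p * ((s * Complex.I) • S))) i j.rev -
        (leadZero q₀ v p z + GamBd q₀ p * (((s : ℂ) / q₀) •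
          (S * !![0, 0, 1; 0, 0, 0; 1, 0, 0]) : Matrix (Fin 3) (Fin 3) ℂ)) i j‖ ≤ K * ‖z‖ := by
  have h0 : (q₀ : ℂ) ≠ 0 := by exact_mod_cast hq₀.ne'
  set M := GamBd q₀ p * S
  have hM1 : GamBd q₀ p * ((s * Complex.I) • S) = (s * Complex.I) • M := Matrix.mul_smul _ _ _
  have hM2 : GamBd q₀ p * (((s : ℂ) / q₀) • (S * !![0, 0, 1; 0, 0, 0; 1, 0, 0])) =
      ((s : ℂ) / q₀) • (M * !![0, 0, 1; 0, 0, 0; 1, 0, 0]) := by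
    rw [Matrix.mul_smul, ← Matrix.mul_assoc]
  rw [hM1, hM2]
  fin_cases j
  · refine ⟨0, fun z hz => ?_⟩
    rw [zero_mul, norm_le_zero_iff]
    fin_cases i <;>
      simp [symmFactor, leadInf, leadZero, conjugatePoint, Matrix.mul_apply, Fin.sum_univ_three] <;>
      field_simp <;> ring_nf <;>
      simp only [Complex.I_sq] <;> ring
  -- The middle column has factor `1`, so its whole `1/ẑ` term is `O(z)` and supplies the constant;
  -- the indicator selects the entry of `leadInf` in the last row.
  · refine ⟨‖(-(Complex.I * herm p (perp v)) / q₀ * (if i = 2 then 1 else 0) +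
      s * Complex.I * M i 1) / (q₀ : ℂ) ^ 2‖, fun z hz => ?_⟩
    rw [← norm_mul, ← norm_neg]
    refine le_of_eq (congrArg _ ?_)
    fin_cases i <;>
      simp [symmFactor, leadInf, leadZero, conjugatePoint, Matrix.mul_apply, Fin.sum_univ_three] <;>
      field_simp
    ring
  · refine ⟨0, fun z hz => ?_⟩
    rw [zero_mul, norm_le_zero_iff]
    fin_cases i <;>
      simp [symmFactor, leadInf, leadZero, conjugatePoint, Matrix.mul_apply, Fin.sum_univ_three] <;>
      field_simp <;> ring_nf <;>
      simp only [Complex.I_sq] <;> ring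

end Symmetry

end CMKdV

end

theorem mainTheorem5 (e : CMKdV.SpatialEnd) (q₀ : ℝ) (hq₀ : 0 < q₀)
    (q : ℝ → ℝ → CMKdV.Pot) (p : CMKdV.Pot) (hp : ‖p‖ = q₀) (t : ℝ)
    (hsmooth : ContDiff ℝ 2 (fun x => q x t))
    (hbdry : CMKdV.HasBoundaryValue e (fun x => q x t) p) :
    (∀ j : Fin 3, ∀ z ∈ CMKdV.region e q₀ j,
      ∃! φ : ℝ → Fin 3 → ℂ, CMKdV.IsJostColumn e q₀ q p t z j φ) ∧
    ∀ (j : Fin 3) (Φ : ℂ → ℝ → Fin 3 → ℂ),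
      (∀ z ∈ CMKdV.region e q₀ j, CMKdV.IsJostColumn e q₀ q p t z j (Φ z)) →
      ∀ (x : ℝ) (i : Fin 3),
        ((fun z : ℂ => CMKdV.modify q₀ t z j (Φ z) x i -
            (CMKdV.leadInf q₀ (q x t) p z +
              (1 / z) • (CMKdV.GamBd q₀ p * CMKdV.E1 e q₀ q p x t)) i j)
          =O[Bornology.cobounded ℂ ⊓ 𝓟 (CMKdV.region e q₀ j)] fun z : ℂ => 1 / z ^ 2) ∧
        ((fun z : ℂ => CMKdV.modify q₀ t z j (Φ z) x i -
            (CMKdV.leadZero q₀ (q x t) p z +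
              CMKdV.GamBd q₀ p * CMKdV.F0 e q₀ q p x t) i j)
          =O[𝓝[CMKdV.region e q₀ j] 0] fun z : ℂ => z) := by
  constructor
  · intro j z hz
    obtain ⟨m, hm, huniq⟩ := CMKdV.existsUnique_isModifiedColumn hq₀ hp hz hsmooth.continuous
      (hbdry.integrableNear_Qmat_sub hsmooth.continuous 0).2
    refine ⟨_, hm.isJostColumn, fun φ hφ => ?_⟩
    rw [← CMKdV.exp_smul_modify q₀ t z j φ, huniq _ hφ.isModifiedColumn]
  · intro j Φ hΦ x i
    constructor
    · obtain ⟨C, hC⟩ := hbdry.exists_expansion_bound hsmooth hq₀ hp j x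
      refine IsBigO.of_bound C (eventually_inf_principal.2 ?_)
      filter_upwards [hC] with z hCz hz
      exact hCz hz _ (hΦ z hz).isModifiedColumn i
    -- Near `0` the expansion at infinity is applied to the reversed column at `-q₀²/z`.
    · obtain ⟨C, hC⟩ := hbdry.exists_expansion_bound hsmooth hq₀ hp j.rev x
      obtain ⟨K, hK⟩ := CMKdV.exists_leadZero_bound hq₀ e.sgn (q x t) p
        (CMKdV.bdIntegral e q₀ q p x t) i j
      refine IsBigO.of_bound (|C| * ((q₀ + 1) / q₀ ^ 4) + K) ?_
      have hball : ∀ᶠ z in 𝓝[CMKdV.region e q₀ j] (0 : ℂ), ‖z‖ ≤ 1 := by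
        refine nhdsWithin_le_nhds ?_
        filter_upwards [Metric.closedBall_mem_nhds (0 : ℂ) one_pos] with z hz
        simpa using hz
      filter_upwards [(CMKdV.tendsto_conjugatePoint hq₀ j).eventually hC, hball,
        self_mem_nhdsWithin] with z hCz hz1 hz
      have hz0 : z ≠ 0 := hz.1
      have h1 := hCz (CMKdV.conjugatePoint_mem_region hq₀ hz) _
        ((hΦ z hz).isModifiedColumn.conjugatePoint hq₀ hz0) i
      have h2 := hK z hz0
      have h3 := CMKdV.norm_symmFactor_mul_le hq₀ hz0 hz1 j
      have hs := CMKdV.symmFactor_ne_zero hq₀ hz0 j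
      set s := CMKdV.symmFactor q₀ z j
      set μ := CMKdV.modify q₀ t z j (Φ z) x i
      set a := (CMKdV.leadInf q₀ (q x t) p (CMKdV.conjugatePoint q₀ z) +
        (1 / CMKdV.conjugatePoint q₀ z) • (CMKdV.GamBd q₀ p *
          ((e.sgn * Complex.I) • CMKdV.bdIntegral e q₀ q p x t))) i j.rev
      set b := (CMKdV.leadZero q₀ (q x t) p z + CMKdV.GamBd q₀ p * CMKdV.F0 e q₀ q p x t) i j
      change ‖s⁻¹ * μ - a‖ ≤ _ at h1
      change ‖s * a - b‖ ≤ _ at h2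
      -- The first term is the rescaled remainder at `-q₀²/z`, the second the discrepancy of the
      -- explicit parts; each is `O(z)`.
      have h4 : μ - b = s * (s⁻¹ * μ - a) + (s * a - b) := by
        rw [mul_sub, mul_inv_cancel_left₀ hs]
        ring
      rw [h4]
      refine (norm_add_le _ _).trans ?_
      rw [norm_mul, add_mul]
      refine add_le_add ?_ h2
      calc ‖s‖ * ‖s⁻¹ * μ - a‖ ≤ ‖s‖ * (|C| * ‖1 / CMKdV.conjugatePoint q₀ z ^ 2‖) := by
            gcongr
            exact h1.trans (mul_le_mul_of_nonneg_right (le_abs_self C) (norm_nonneg _))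
        _ = |C| * (‖s‖ * ‖1 / CMKdV.conjugatePoint q₀ z ^ 2‖) := by ring
        _ ≤ |C| * (((q₀ + 1) / q₀ ^ 4) * ‖z‖) := by gcongr
        _ = _ := by ring
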